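/- Let $\theta>0$. Let $\mathbb Y$ be the Young graph: vertices are Young diagrams (finite order ideals of $\mathbb Z_{>0}^2$), $|\lambda|$ is the number of boxes of $\lambda$, and $\mu\nearrow\nu$ means that $\nu$ is obtained from $\mu$ by adding one box, denoted $\nu/\mu$. Put $$F_\theta(a,l)=\frac{(a+\theta(l+2))(a+1+\theta l)}{(a+\theta(l+1))(a+1+\theta(l+1))}.$$ For $\mu\nearrow\nu$ let $\kappa_\theta(\mu,\nu)=\prod F_\theta(a,l)$ over the boxes of $\mu$ above $\nu/\mu$ in its column, $a,l$ being the arm and leg lengths with respect to $\mu$; let $\kappa^*_\theta(\mu,\nu)=\prod F_\theta(a,l)$ over all boxes outside $\nu$ below $\nu/\mu$ in its column, $a$ and $l$ being the numbers of boxes strictly between that box and $\nu$ in its row and in its column respectively (the infinite product converges); and let $\tilde\kappa_\theta=\sqrt{\kappa_\theta\kappa_\theta^*}$. Let $\ell^2_{\mathrm{fin}}(\mathbb Y)$ be the space of finitely supported functions $\mathbb Y\to\mathbb C$, with basis $\{1_\lambda\}$ and inner product $(f,g)=\sum_\lambda f(\lambda)\overline{g(\lambda)}$. A triplet of Kerov's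 operators defined by a function $q:\mathbb Z_{>0}^2\to\mathbb C$ is a triple $(U,D,H)$ of linear operators on $\ell^2_{\mathrm{fin}}(\mathbb Y)$ with $$U1_\lambda=\sum_{\nu:\lambda\nearrow\nu}\tilde\kappa_\theta(\lambda,\nu)\,q(\nu/\lambda)\,1_\nu,\qquad D1_\lambda=\sum_{\mu:\mu\nearrow\lambda}\tilde\kappa_\theta(\mu,\lambda)\,q(\lambda/\mu)\,1_\mu,$$ $[H,U]=2U$, $[H,D]=-2D$, $[D,U]=H$, and such that, for some $t\in\mathbb C$, $H1_\lambda=(2|\lambda|+t)1_\lambda$ for all $\lambda$. Then: 1. A function $q$ defines a triplet of Kerov's operators if and only if there are $z,z'\in\mathbb C$ such that for all $(i,j)\in\mathbb Z_{>0}^2$ $$q(i,j)^2=\bigl(z+(j-1)-\theta(i-1)\bigr)\bigl(z'+(j-1)-\theta(i-1)\bigr).$$ The pair $(z,z')$ is determined by $q^2$ up to order. 2. In that case $t=(H1_\varnothing,1_\varnothing)=zz'/\theta$. 3. In that case let $Z_n=\sum_{|\lambda|=n}(U^n1_\varnothing,1_\lambda)(D^n1_\lambda,1_\varnothing)$. Then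 $Z_n=n!\,(t)_n$ with $(t)_n=t(t+1)\cdots(t+n-1)$, and for every $n$ with $Z_n\ne0$ the measure $M_n(\lambda)=Z_n^{-1}(U^n1_\varnothing,1_\lambda)(D^n1_\lambda,1_\varnothing)$ on the diagrams with $n$ boxes is the (possibly degenerate, possibly complex-valued) $z$-measure with Jack parameter $\theta$: $$M_n(\lambda)=\frac{n!}{(t)_n}\prod_{(i,j)\in\lambda}\frac{(z+(j-1)-\theta(i-1))(z'+(j-1)-\theta(i-1))}{(a(i,j)+\theta l(i,j)+1)(a(i,j)+\theta l(i,j)+\theta)},$$ where $a(i,j)$ and $l(i,j)$ are the arm and leg lengths of the box $(i,j)$ in $\lambda$. -/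

import Mathlib

namespace KerovJack

/-- `μ ↗ ν` in the Young graph: `ν` is obtained from `μ` by adding one box.  Young diagrams are the
finite order ideals of the poset of boxes; row and column indices start from `0`. -/
def Edge (μ ν : YoungDiagram) : Prop :=
  μ ≤ ν ∧ ν.card = μ.card + 1

/-- The box `ν / μ` of an edge `μ ↗ ν`: the set difference has exactly one element, so the sum of
its elements is that element. -/
def newBox (μ ν : YoungDiagram) : ℕ × ℕ :=
  ∑ x ∈ ν.cells \ μ.cells, x

/-- The rational function `F_θ(a, l)` in the Pieri rule for Jack symmetric functions. -/
noncomputable def F (θ a l : ℝ) : ℝ :=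
  ((a + θ * (l + 2)) * (a + 1 + θ * l)) / ((a + θ * (l + 1)) * (a + 1 + θ * (l + 1)))

/-- The Jack edge multiplicity `κ_θ(μ, ν)`: the product over the boxes `(i, j)` of `μ` above the
new box (in its column `j`) of `F_θ(a, l)`, where `a` and `l` are the arm and leg lengths of the
box with respect to `μ`. -/
noncomputable def jackMult (θ : ℝ) (μ ν : YoungDiagram) : ℝ :=
  ∏ i ∈ Finset.range (newBox μ ν).1,
    F θ ((μ.rowLen i : ℝ) - (newBox μ ν).2 - 1) ((μ.colLen (newBox μ ν).2 : ℝ) - i - 1)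

/-- The dual Jack edge multiplicity `κ*_θ(μ, ν)`: the product over the boxes `(i, j)` outside `ν`
below the new box (in its column `j`), that is `i = ν.colLen j + k` with `k = 0, 1, 2, …`, of
`F_θ(a, l)`, where `a = j - ν.rowLen i` and `l = k` are the numbers of boxes strictly between
`(i, j)` and `ν` in the row and in the column of `(i, j)`.  For `θ > 0` the infinite product
converges absolutely. -/
noncomputable def jackMultDual (θ : ℝ) (μ ν : YoungDiagram) : ℝ :=
  ∏' k : ℕ,
    F θ (((newBox μ ν).2 : ℝ) - ν.rowLen (ν.colLen (newBox μ ν).2 + k)) k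

/-- The UD-self-dual Jack edge multiplicity `κ̃_θ = √(κ_θ κ*_θ)`. -/
noncomputable def jackMultSelfDual (θ : ℝ) (μ ν : YoungDiagram) : ℝ :=
  Real.sqrt (jackMult θ μ ν * jackMultDual θ μ ν)

/-- The space of finitely supported complex functions on the Young graph. -/
abbrev FinFun : Type := YoungDiagram →₀ ℂ

/-- The basis vector `1_λ`. -/
noncomputable def basisVec (lam : YoungDiagram) : FinFun :=
  Finsupp.single lam 1

open Classical in
/-- `(U, D, H)` is the triplet of Kerov's operators defined by the function `q` on boxes, for the
Young graph with edge multiplicities `κ`: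
`U 1_λ = ∑_{ν ↘ λ} κ(λ, ν) q(ν/λ) 1_ν` and `D 1_λ = ∑_{μ ↗ λ} κ(μ, λ) q(λ/μ) 1_μ`, the
`sl(2, ℂ)` commutation relations hold, and `1_λ` is an eigenvector of `H` with an eigenvalue that
depends only on the level, namely `2|λ| + t`. -/
structure IsKerovTriplet (κ : YoungDiagram → YoungDiagram → ℝ) (q : ℕ × ℕ → ℂ)
    (U D H : Module.End ℂ FinFun) : Prop where
  up : ∀ lam ν : YoungDiagram,
    U (basisVec lam) ν = if Edge lam ν then (κ lam ν : ℂ) * q (newBox lam ν) else 0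
  down : ∀ lam μ : YoungDiagram,
    D (basisVec lam) μ = if Edge μ lam then (κ μ lam : ℂ) * q (newBox μ lam) else 0
  comm_H_U : ⁅H, U⁆ = (2 : ℂ) • U
  comm_H_D : ⁅H, D⁆ = (-2 : ℂ) • D
  comm_D_U : ⁅D, U⁆ = H
  weight : ∃ t : ℂ, ∀ lam : YoungDiagram,
    H (basisVec lam) = (2 * (lam.card : ℂ) + t) • basisVec lam

/-- `(H 1_∅, 1_∅)`, the eigenvalue of the initial vector. -/
noncomputable def vacuumWeight (H : Module.End ℂ FinFun) : ℂ :=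
  H (basisVec ⊥) ⊥

/-- `(U^n 1_∅, 1_λ) (D^n 1_λ, 1_∅)`. -/
noncomputable def unnormalizedWeight (U D : Module.End ℂ FinFun) (n : ℕ) (lam : YoungDiagram) : ℂ :=
  (U ^ n) (basisVec ⊥) lam * (D ^ n) (basisVec lam) ⊥

/-- The constant `Z_n`: the sum of the weights over all Young diagrams with `n` boxes. -/
noncomputable def normalization (U D : Module.End ℂ FinFun) (n : ℕ) : ℂ :=
  ∑ᶠ (lam : YoungDiagram) (_ : lam.card = n), unnormalizedWeight U D n lam

/-- The measure `M_n` on diagrams with `n` boxes arising from `U` and `D`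
(meaningful when `Z_n ≠ 0`). -/
noncomputable def kerovMeasure (U D : Module.End ℂ FinFun) (n : ℕ) (lam : YoungDiagram) : ℂ :=
  unnormalizedWeight U D n lam / normalization U D n

/-- The `θ`-content `c_θ` of a box (column index minus `θ` times row index, counted from `0`). -/
noncomputable def content (θ : ℝ) (x : ℕ × ℕ) : ℂ :=
  (x.2 : ℂ) - (θ : ℂ) * (x.1 : ℂ)

/-- `H(λ, θ) H'(λ, θ)`: the product over boxes of `(a + θ l + 1) (a + θ l + θ)`, with `a` and `l`
the arm and leg lengths. -/
noncomputable def hookProduct (θ : ℝ) (lam : YoungDiagram) : ℝ :=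
  ∏ x ∈ lam.cells,
    ((((lam.rowLen x.1 : ℝ) - x.2 - 1) + θ * ((lam.colLen x.2 : ℝ) - x.1 - 1) + 1) *
      (((lam.rowLen x.1 : ℝ) - x.2 - 1) + θ * ((lam.colLen x.2 : ℝ) - x.1 - 1) + θ))

/-- The `z`-measure with Jack parameter `θ` at a diagram `λ` with `n` boxes:
`n! / (t)_n * ∏_{x ∈ λ} (z + c_θ(x)) (z' + c_θ(x)) / (H(λ, θ) H'(λ, θ))`, where `t = z z' / θ`
and `(t)_n = t (t + 1) ⋯ (t + n - 1)` (meaningful when `(t)_n ≠ 0`). -/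
noncomputable def jackZMeasure (θ : ℝ) (z z' : ℂ) (n : ℕ) (lam : YoungDiagram) : ℂ :=
  (n.factorial : ℂ) / (ascPochhammer ℂ n).eval (z * z' / (θ : ℂ)) *
    ((∏ x ∈ lam.cells, ((z + content θ x) * (z' + content θ x))) / (hookProduct θ lam : ℂ))

end KerovJack

/-!
Write `π = κ_θ κ*_θ` for the square of the self-dual multiplicity, and let `e_i = λ_i - θ i` be the
content of the first box to the right of row `i`. The weight of adding a box to row `i` takes the
form `π = ∏_{k ≠ i} G (e_i - e_k)` with `G u = (u + θ) (u + 1 - θ) / (u (u + 1))`; the empty rows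
contribute a telescoping product (`EdgeAt.edgeWeight_lower`, `EdgeAt.edgeWeight_upper`). Everything
follows from this row form.

* Since `G (-u) = G (u - 1)`, the products of the two upper and of the two lower weights around a
  square of the Young graph agree (`edgeWeight_square`). Hence the off-diagonal matrix elements of
  `[D, U]` vanish for every `q`, and `q` defines a triplet if and only if
  `∑_{ν ↘ λ} π(λ, ν) q(ν/λ)² - ∑_{μ ↗ λ} π(μ, λ) q(λ/μ)² = 2 |λ| + t` for some `t` and
  all `λ`.

* The numbers `± θ (1 - θ) π` are the residues of the rational function `∏_k G (X - e_k)` at `e_i`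
  and `e_i - 1`. Evaluating the sums of residues by divided differences shows that the moments of
  order `0, 1, 2` of `π` with respect to the content, upward minus downward, are `1 / θ`, `0` and
  `2 |λ|` (`sum_edgeWeight_mul_pow`). The poles are simple when `θ` is irrational, and both sides are
  continuous in `θ`. So `q² = (z + c) (z' + c)` satisfies the relations, with `t = z z' / θ`.

* Conversely, the relations at the rectangles without corner determine `q²` from its values at the
  first two boxes of the first row (`eq_zero_of_relations`), and two values can be matched by a choice
  of `z` and `z'`.

* The weighted sums over paths that give `(U^n 1_∅, 1_λ)` and `(D^n 1_λ, 1_∅)` both equal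
  `n! / √(H H') ∏ q`. This reduces to two facts about the numbers
  `w_i = (e_i + θ (M - 1)) ∏_{k ≠ i} (e_i - e_k - θ) / (e_i - e_k)` over the first `M` rows: they sum
  to `|λ|` (again a divided difference), and `π(μ, λ) = w_i² H H'(μ) / H H'(λ)`. For the latter, a
  telescoping product along the boundary of the diagram (`prod_boundary_telescope`) converts
  products over the rows below a box into products over the columns to its left. The constant `Z_n`
  is `(D^n U^n 1_∅, 1_∅)`, which the `sl(2)` relations evaluate.
-/

namespace KerovJack

open Filter Topology Polynomial

/-! ### Divided differences -/

/-- The divided difference of the polynomial `P` at the points of `S`, in the form of a sum of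
residues of `P / ∏ r ∈ S, (X - r)`. -/
noncomputable def dividedDiff (S : Finset ℝ) (P : Polynomial ℝ) : ℝ :=
  ∑ r ∈ S, P.eval r / ∏ r' ∈ S.erase r, (r - r')

theorem dividedDiff_add (S : Finset ℝ) (P Q : ℝ[X]) :
    dividedDiff S (P + Q) = dividedDiff S P + dividedDiff S Q := by
  simp [dividedDiff, add_div, Finset.sum_add_distrib]

theorem dividedDiff_C_mul (S : Finset ℝ) (c : ℝ) (P : ℝ[X]) :
    dividedDiff S (C c * P) = c * dividedDiff S P := by
  simp [dividedDiff, Finset.mul_sum, mul_div_assoc]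

theorem dividedDiff_insert_X_sub_C_mul {S : Finset ℝ} {a : ℝ} (ha : a ∉ S) (P : ℝ[X]) :
    dividedDiff (insert a S) ((X - C a) * P) = dividedDiff S P := by
  unfold dividedDiff
  rw [Finset.sum_insert ha]
  simp only [eval_mul, eval_sub, eval_X, eval_C, sub_self, zero_mul, zero_div, zero_add]
  refine Finset.sum_congr rfl fun r hr => ?_
  have hra : r ≠ a := fun h => ha (h ▸ hr)
  rw [Finset.erase_insert_of_ne hra.symm, Finset.prod_insert (fun h => ha (Finset.mem_of_mem_erase h)),
    mul_div_mul_left _ _ (sub_ne_zero.2 hra)]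

theorem dividedDiff_of_degree_lt {S : Finset ℝ} {P : ℝ[X]} (h : P.degree < S.card) :
    dividedDiff S P = P.coeff (S.card - 1) := by
  simpa [dividedDiff] using (Lagrange.coeff_eq_sum (v := id) (s := S) (Set.injOn_id _) h).symm

theorem dividedDiff_eq_zero {S : Finset ℝ} {P : ℝ[X]} (h : P.natDegree + 1 < S.card) :
    dividedDiff S P = 0 := by
  rw [dividedDiff_of_degree_lt, coeff_eq_zero_of_natDegree_lt (by omega)]
  exact degree_le_natDegree.trans_lt (by exact_mod_cast (by omega))

theorem dividedDiff_eq_one {S : Finset ℝ} {P : ℝ[X]} (hP : P.Monic)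
    (h : P.natDegree + 1 = S.card) : dividedDiff S P = 1 := by
  rw [dividedDiff_of_degree_lt, ← h, Nat.add_sub_cancel, hP.coeff_natDegree]
  exact degree_le_natDegree.trans_lt (by exact_mod_cast (by omega))

theorem dividedDiff_eq_nextCoeff {S : Finset ℝ} {P : ℝ[X]} (hP : P.Monic) (h0 : S.Nonempty)
    (h : P.natDegree = S.card) : dividedDiff S P = P.nextCoeff + ∑ r ∈ S, r := by
  have hc : 0 < S.card := h0.card_pos
  have hNm : (Lagrange.nodal S id : ℝ[X]).Monic := Lagrange.nodal_monic
  have hNd : (Lagrange.nodal S id : ℝ[X]).natDegree = S.card := Lagrange.natDegree_nodal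
  -- subtracting the monic polynomial that vanishes on `S` lowers the degree
  have h1 : dividedDiff S P = dividedDiff S (P - Lagrange.nodal S id) := by
    refine Finset.sum_congr rfl fun r hr => ?_
    have := Lagrange.eval_nodal_at_node (v := id) hr
    simp only [id] at this
    rw [eval_sub]
    simp only [this, sub_zero]
  rw [h1, dividedDiff_of_degree_lt, coeff_sub]
  · have hN : (Lagrange.nodal S id : ℝ[X]).nextCoeff = - ∑ r ∈ S, r := by
      simpa [Lagrange.nodal_eq] using prod_X_sub_C_nextCoeff (s := S) (fun r : ℝ => r)
    rw [nextCoeff_of_natDegree_pos (by omega), hNd] at hN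
    rw [nextCoeff_of_natDegree_pos (by omega), h, hN]
    ring
  · rw [← h, ← degree_eq_natDegree hP.ne_zero]
    refine degree_sub_lt_left ?_ hP.ne_zero ?_
    · rw [degree_eq_natDegree hP.ne_zero, degree_eq_natDegree hNm.ne_zero, h, hNd]
    · rw [hP.leadingCoeff, hNm.leadingCoeff]

/-! ### The weights that sum to the number of boxes -/

/-- The numerator `∏ j < n, (X - e j - θ)` of the weights `∏ j ≠ i, (e i - e j - θ) / (e i - e j)`. -/
noncomputable def shiftProd (θ : ℝ) (e : ℕ → ℝ) (n : ℕ) : ℝ[X] :=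
  ∏ j ∈ Finset.range n, (X - C (e j + θ))

theorem shiftProd_monic (θ : ℝ) (e : ℕ → ℝ) (n : ℕ) : (shiftProd θ e n).Monic :=
  monic_prod_of_monic _ _ fun _ _ => monic_X_sub_C _

theorem shiftProd_natDegree (θ : ℝ) (e : ℕ → ℝ) (n : ℕ) : (shiftProd θ e n).natDegree = n := by
  rw [shiftProd, natDegree_prod_of_monic _ _ fun j _ => monic_X_sub_C (e j + θ)]
  simp only [natDegree_X_sub_C, Finset.sum_const, Finset.card_range, smul_eq_mul, mul_one]

theorem shiftProd_nextCoeff (θ : ℝ) (e : ℕ → ℝ) (n : ℕ) :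
    (shiftProd θ e n).nextCoeff = - ∑ j ∈ Finset.range n, (e j + θ) :=
  prod_X_sub_C_nextCoeff _

/-- The induction on `n` rests on `X - e - θ = (X - e) - θ`: in the first summand the new point drops
out, and in the second the degree is low enough for an explicit evaluation. -/
theorem dividedDiff_shiftProd (θ : ℝ) (e : ℕ → ℝ) (n : ℕ)
    (he : Set.InjOn e (Finset.range n)) :
    dividedDiff ((Finset.range n).image e) (shiftProd θ e n) = -θ * n ∧
    dividedDiff ((Finset.range n).image e) (shiftProd θ e n * X) =
      -θ * ∑ j ∈ Finset.range n, (e j - θ * j) := by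
  induction n with
  | zero => simp [dividedDiff]
  | succ n ih =>
    have hsub : (Finset.range n : Set ℕ) ⊆ Finset.range (n + 1) := by
      intro x hx; simp at hx ⊢; omega
    obtain ⟨ih1, ih2⟩ := ih (he.mono hsub)
    have hcard : ((Finset.range n).image e).card = n := by
      rw [Finset.card_image_of_injOn (he.mono hsub), Finset.card_range]
    have hnot : e n ∉ (Finset.range n).image e := by
      simp only [Finset.mem_image, Finset.mem_range, not_exists, not_and]
      intro j hj h
      have := he (by simp; omega) (by simp) h
      omega
    have himg : (Finset.range (n + 1)).image e = insert (e n) ((Finset.range n).image e) := by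
      rw [Finset.range_add_one, Finset.image_insert]
    have hcard' : (insert (e n) ((Finset.range n).image e)).card = n + 1 := by
      rw [Finset.card_insert_of_notMem hnot, hcard]
    have hP : shiftProd θ e (n + 1) = (X - C (e n)) * shiftProd θ e n + C (-θ) * shiftProd θ e n := by
      simp only [shiftProd, Finset.prod_range_succ, C_add, C_neg]; ring
    have hM := shiftProd_monic θ e n
    rw [himg]
    constructor
    · rw [hP, dividedDiff_add, dividedDiff_insert_X_sub_C_mul hnot, dividedDiff_C_mul, ih1,
        dividedDiff_eq_one hM (by rw [hcard', shiftProd_natDegree])]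
      push_cast; ring
    · have hP' : shiftProd θ e (n + 1) * X = (X - C (e n)) * (shiftProd θ e n * X) +
          C (-θ) * (shiftProd θ e n * X) := by rw [hP]; ring
      have hsum : ∑ r ∈ (Finset.range n).image e, r = ∑ j ∈ Finset.range n, e j :=
        Finset.sum_image (he.mono hsub)
      rw [hP', dividedDiff_add, dividedDiff_insert_X_sub_C_mul hnot, dividedDiff_C_mul, ih2,
        dividedDiff_eq_nextCoeff (hM.mul monic_X) (Finset.insert_nonempty _ _)
          (by rw [hcard', hM.natDegree_mul monic_X, shiftProd_natDegree, natDegree_X]),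
        hM.nextCoeff_mul monic_X, shiftProd_nextCoeff, Finset.sum_insert hnot, hsum,
        Finset.sum_range_succ]
      have : (X : ℝ[X]).nextCoeff = 0 := by simp [nextCoeff]
      rw [this, Finset.sum_add_distrib]
      simp only [Finset.sum_const, Finset.card_range, nsmul_eq_mul]
      ring

/-- Evaluation of `∑ i, (e i + c) ∏ j ≠ i, (e i - e j - θ) / (e i - e j)`. -/
theorem sum_mul_prod_sub_div (θ : ℝ) (hθ : θ ≠ 0) (e : ℕ → ℝ) (n : ℕ) (c : ℝ)
    (he : Set.InjOn e (Finset.range n)) :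
    ∑ i ∈ Finset.range n, (e i + c) *
      ∏ j ∈ (Finset.range n).erase i, (e i - e j - θ) / (e i - e j) =
      ∑ j ∈ Finset.range n, (e j - θ * j) + c * n := by
  obtain ⟨h1, h2⟩ := dividedDiff_shiftProd θ e n he
  have key : ∀ f : Polynomial ℝ, dividedDiff ((Finset.range n).image e) (shiftProd θ e n * f) =
      -θ * ∑ i ∈ Finset.range n, f.eval (e i) *
        ∏ j ∈ (Finset.range n).erase i, (e i - e j - θ) / (e i - e j) := by
    intro f
    rw [dividedDiff, Finset.sum_image he, Finset.mul_sum]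
    refine Finset.sum_congr rfl fun i hi => ?_
    have her : ((Finset.range n).image e).erase (e i) = ((Finset.range n).erase i).image e := by
      ext x
      simp only [Finset.mem_erase, Finset.mem_image]
      constructor
      · rintro ⟨hx, j, hj, rfl⟩
        exact ⟨j, ⟨fun h => hx (by rw [h]), hj⟩, rfl⟩
      · rintro ⟨j, ⟨hj, hj'⟩, rfl⟩
        exact ⟨fun h => hj (he hj' hi h), j, hj', rfl⟩
    rw [her, Finset.prod_image (he.mono (Finset.coe_subset.2 (Finset.erase_subset _ _))),
      Finset.prod_div_distrib, Polynomial.eval_mul, shiftProd, Polynomial.eval_prod,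
      ← Finset.mul_prod_erase _ _ hi]
    simp only [Polynomial.eval_sub, Polynomial.eval_X, Polynomial.eval_C, sub_sub]
    ring
  have k1 := key 1
  have k2 := key Polynomial.X
  rw [mul_one, h1] at k1
  rw [h2] at k2
  simp only [Polynomial.eval_one, one_mul, Polynomial.eval_X] at k1 k2
  have hθ' : -θ ≠ 0 := neg_ne_zero.2 hθ
  have k1' := mul_left_cancel₀ hθ' k1
  have k2' := mul_left_cancel₀ hθ' k2
  simp only [add_mul, Finset.sum_add_distrib, ← Finset.mul_sum]
  rw [← k1', ← k2']

/-! ### Moments of the Jack edge weights, for generic contents -/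

/-- The row form of the factor `F`: the contribution of a row whose content (at its end) differs by
`u` from the content of the new box. -/
noncomputable def rowFactor (θ u : ℝ) : ℝ :=
  ((u + θ) * (u + 1 - θ)) / (u * (u + 1))

/-- Numerator of `∏ j, rowFactor θ (X - e j) * (X - b + 1 - θ) / (X - b)`. -/
noncomputable def jackNum (θ : ℝ) (e : ℕ → ℝ) (b : ℝ) (n : ℕ) : ℝ[X] :=
  (X - C (b - 1 + θ)) * ∏ j ∈ Finset.range n, ((X - C (e j - θ)) * (X - C (e j - 1 + θ)))

/-- The poles of `∏ j, rowFactor θ (X - e j) * (X - b + 1 - θ) / (X - b)`. -/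
noncomputable def jackPoles (e : ℕ → ℝ) (b : ℝ) (s : Finset ℕ) : Finset ℝ :=
  insert b (s.image e ∪ s.image fun j => e j - 1)

/-- The poles `b`, `e j`, `e j - 1` for `j < n` are pairwise distinct. -/
structure SimplePoles (e : ℕ → ℝ) (b : ℝ) (n : ℕ) : Prop where
  inj : ∀ i < n, ∀ j < n, e i = e j → i = j
  shift : ∀ i < n, ∀ j < n, e i ≠ e j - 1
  left : ∀ i < n, e i ≠ b
  right : ∀ i < n, e i - 1 ≠ b

theorem SimplePoles.of_succ {e : ℕ → ℝ} {b : ℝ} {n : ℕ} (h : SimplePoles e b (n + 1)) :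
    SimplePoles e b n :=
  ⟨fun i hi j hj => h.inj i (by omega) j (by omega), fun i hi j hj => h.shift i (by omega) j (by omega),
    fun i hi => h.left i (by omega), fun i hi => h.right i (by omega)⟩

theorem jackPoles_insert (e : ℕ → ℝ) (b : ℝ) (s : Finset ℕ) (i : ℕ) :
    jackPoles e b (insert i s) = insert (e i) (insert (e i - 1) (jackPoles e b s)) := by
  ext x
  simp only [jackPoles, Finset.image_insert, Finset.mem_insert, Finset.mem_union]
  tauto

theorem SimplePoles.notMem {e : ℕ → ℝ} {b : ℝ} {n : ℕ} (h : SimplePoles e b n) {i : ℕ} (hi : i < n)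
    {s : Finset ℕ} (hs : s ⊆ Finset.range n) (his : i ∉ s) :
    e i - 1 ∉ jackPoles e b s ∧ e i ∉ insert (e i - 1) (jackPoles e b s) := by
  have hs' : ∀ j ∈ s, j < n := fun j hj => Finset.mem_range.1 (hs hj)
  simp only [jackPoles, Finset.mem_insert, Finset.mem_union, Finset.mem_image, not_or, not_exists,
    not_and]
  refine ⟨⟨h.right i hi, fun j hj hij => h.shift j (hs' j hj) i hi hij, fun j hj hij => his ?_⟩,
    by linarith, h.left i hi, fun j hj hij => his ?_, fun j hj hij =>
      h.shift i hi j (hs' j hj) hij.symm⟩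
  · rwa [← h.inj j (hs' j hj) i hi (by linarith)]
  · rwa [← h.inj j (hs' j hj) i hi hij]

/-- Products over the poles, as products over the index set. -/
theorem SimplePoles.prod {e : ℕ → ℝ} {b : ℝ} {n : ℕ} (h : SimplePoles e b n) (f : ℝ → ℝ)
    (s : Finset ℕ) (hs : s ⊆ Finset.range n) :
    ∏ r ∈ jackPoles e b s, f r = f b * ∏ j ∈ s, f (e j) * f (e j - 1) := by
  induction s using Finset.induction_on with
  | empty => simp [jackPoles]
  | insert i s his ih =>
    have hi : i < n := Finset.mem_range.1 (hs (Finset.mem_insert_self _ _))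
    have hs' : s ⊆ Finset.range n := (Finset.subset_insert _ _).trans hs
    obtain ⟨h1, h2⟩ := h.notMem hi hs' his
    rw [jackPoles_insert, Finset.prod_insert h2, Finset.prod_insert h1, Finset.prod_insert his,
      ih hs']
    ring

theorem SimplePoles.sum {e : ℕ → ℝ} {b : ℝ} {n : ℕ} (h : SimplePoles e b n) (f : ℝ → ℝ)
    (s : Finset ℕ) (hs : s ⊆ Finset.range n) :
    ∑ r ∈ jackPoles e b s, f r = f b + ∑ j ∈ s, (f (e j) + f (e j - 1)) := by
  induction s using Finset.induction_on with
  | empty => simp [jackPoles]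
  | insert i s his ih =>
    have hi : i < n := Finset.mem_range.1 (hs (Finset.mem_insert_self _ _))
    have hs' : s ⊆ Finset.range n := (Finset.subset_insert _ _).trans hs
    obtain ⟨h1, h2⟩ := h.notMem hi hs' his
    rw [jackPoles_insert, Finset.sum_insert h2, Finset.sum_insert h1, Finset.sum_insert his,
      ih hs']
    ring

theorem SimplePoles.card {e : ℕ → ℝ} {b : ℝ} {n : ℕ} (h : SimplePoles e b n) :
    (jackPoles e b (Finset.range n)).card = 2 * n + 1 := by
  have h1 := h.sum (fun _ => 1) _ subset_rfl
  simp only [Finset.sum_const, Finset.card_range, nsmul_eq_mul, mul_one] at h1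
  have : ((jackPoles e b (Finset.range n)).card : ℝ) = (2 * n + 1 : ℕ) := by
    rw [h1]; push_cast; ring
  exact_mod_cast this

theorem jackNum_monic (θ : ℝ) (e : ℕ → ℝ) (b : ℝ) (n : ℕ) : (jackNum θ e b n).Monic :=
  (monic_X_sub_C _).mul (monic_prod_of_monic _ _ fun _ _ => (monic_X_sub_C _).mul (monic_X_sub_C _))

theorem jackNum_natDegree (θ : ℝ) (e : ℕ → ℝ) (b : ℝ) (n : ℕ) :
    (jackNum θ e b n).natDegree = 2 * n + 1 := by
  have h : ∀ j, ((X - C (e j - θ)) * (X - C (e j - 1 + θ))).natDegree = 2 := fun j => by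
    rw [(monic_X_sub_C _).natDegree_mul (monic_X_sub_C _), natDegree_X_sub_C, natDegree_X_sub_C]
  rw [jackNum, (monic_X_sub_C _).natDegree_mul
    (monic_prod_of_monic _ _ fun _ _ => (monic_X_sub_C _).mul (monic_X_sub_C _)),
    natDegree_prod_of_monic _ _ fun _ _ => (monic_X_sub_C _).mul (monic_X_sub_C _),
    natDegree_X_sub_C, Finset.sum_congr rfl fun j _ => h j]
  simp only [Finset.sum_const, Finset.card_range, smul_eq_mul]
  ring

theorem jackNum_nextCoeff (θ : ℝ) (e : ℕ → ℝ) (b : ℝ) (n : ℕ) :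
    (jackNum θ e b n).nextCoeff = 1 - θ - b - ∑ j ∈ Finset.range n, (2 * e j - 1) := by
  rw [jackNum, (monic_X_sub_C _).nextCoeff_mul
    (monic_prod_of_monic _ _ fun _ _ => (monic_X_sub_C _).mul (monic_X_sub_C _)),
    Monic.nextCoeff_prod _ _ fun _ _ => (monic_X_sub_C _).mul (monic_X_sub_C _), nextCoeff_X_sub_C,
    Finset.sum_congr rfl fun j _ => (monic_X_sub_C _).nextCoeff_mul (monic_X_sub_C _)]
  simp only [nextCoeff_X_sub_C]
  rw [sub_eq_add_neg (1 - θ - b), ← Finset.sum_neg_distrib]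
  congr 1
  · ring
  · exact Finset.sum_congr rfl fun j _ => by ring

theorem jackNum_succ (θ : ℝ) (e : ℕ → ℝ) (b : ℝ) (n : ℕ) :
    jackNum θ e b (n + 1) = (X - C (e n)) * ((X - C (e n - 1)) * jackNum θ e b n) +
      C (θ * (1 - θ)) * jackNum θ e b n := by
  simp only [jackNum, Finset.prod_range_succ, C_sub, C_add, C_mul, C_1]
  ring

/-- The divided differences of `jackNum * X ^ k` for `k = 0, 1, 2`. The induction on `n` rests on
`(X - e + θ) (X - e + 1 - θ) = (X - e) (X - e + 1) + θ (1 - θ)`. -/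
theorem SimplePoles.dividedDiff_jackNum {e : ℕ → ℝ} {b : ℝ} {n : ℕ} (θ : ℝ)
    (h : SimplePoles e b n) :
    dividedDiff (jackPoles e b (Finset.range n)) (jackNum θ e b n) = 1 - θ ∧
    dividedDiff (jackPoles e b (Finset.range n)) (jackNum θ e b n * X) =
      (1 - θ) * b + θ * (1 - θ) * n ∧
    dividedDiff (jackPoles e b (Finset.range n)) (jackNum θ e b n * X ^ 2) =
      (1 - θ) * b ^ 2 + θ * (1 - θ) * ∑ j ∈ Finset.range n, (2 * e j - θ) := by
  induction n with
  | zero => simp [dividedDiff, jackPoles, jackNum]; ring_nf; simp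
  | succ n ih =>
    obtain ⟨i0, i1, i2⟩ := ih h.of_succ
    obtain ⟨h1, h2⟩ := h.notMem (Nat.lt_succ_self n) (s := Finset.range n)
      (fun x hx => Finset.mem_range.2 (by have := Finset.mem_range.1 hx; omega)) (by simp)
    have hcard := h.card
    have hsum := h.sum (fun x => x) _ subset_rfl
    rw [Finset.range_add_one, jackPoles_insert] at hcard hsum ⊢
    set S := jackPoles e b (Finset.range n)
    have hM := jackNum_monic θ e b n
    have hd := jackNum_natDegree θ e b n
    have step : ∀ f : ℝ[X], dividedDiff (insert (e n) (insert (e n - 1) S))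
        (jackNum θ e b (n + 1) * f) = dividedDiff S (jackNum θ e b n * f) +
          θ * (1 - θ) * dividedDiff (insert (e n) (insert (e n - 1) S)) (jackNum θ e b n * f) := by
      intro f
      have : jackNum θ e b (n + 1) * f =
          (X - C (e n)) * ((X - C (e n - 1)) * (jackNum θ e b n * f)) +
            C (θ * (1 - θ)) * (jackNum θ e b n * f) := by rw [jackNum_succ]; ring
      rw [this, dividedDiff_add, dividedDiff_insert_X_sub_C_mul h2,
        dividedDiff_insert_X_sub_C_mul h1, dividedDiff_C_mul]
    refine ⟨?_, ?_, ?_⟩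
    · have := step 1
      rw [mul_one, mul_one, i0,
        dividedDiff_eq_zero (P := jackNum θ e b n) (by rw [hcard, hd]; omega)] at this
      rw [this]; ring
    · rw [step, i1, dividedDiff_eq_one (hM.mul monic_X)
        (by rw [hcard, hM.natDegree_mul monic_X, hd, natDegree_X]; omega)]
      push_cast; ring
    · have hX : (X ^ 2 : ℝ[X]).nextCoeff = 0 := by
        rw [monic_X.nextCoeff_pow]; simp [nextCoeff]
      rw [step, i2, dividedDiff_eq_nextCoeff (hM.mul (monic_X_pow 2)) (Finset.insert_nonempty _ _)
        (by rw [hcard, hM.natDegree_mul (monic_X_pow 2), hd, natDegree_X_pow]; omega),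
        hM.nextCoeff_mul (monic_X_pow 2), jackNum_nextCoeff, hX, hsum,
        Finset.sum_insert Finset.notMem_range_self, Finset.sum_insert Finset.notMem_range_self]
      have : ∑ j ∈ Finset.range n, (e j + (e j - 1)) = ∑ j ∈ Finset.range n, (2 * e j - 1) :=
        Finset.sum_congr rfl fun j _ => by ring
      rw [this]; ring

/-- The divided difference as the sum of the residues of
`∏ j, rowFactor θ (X - e j) * (X - b + 1 - θ) / (X - b) * f`: at `e i` and `e i - 1` the factor of
index `i` has the residues `± θ (1 - θ)`, and the hypothesis `hb` makes the residue at `b` vanish. -/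
theorem SimplePoles.dividedDiff_eq_sum {e : ℕ → ℝ} {b : ℝ} {n : ℕ} (θ : ℝ)
    (h : SimplePoles e b n) (f : Polynomial ℝ)
    (hb : ∃ j < n, rowFactor θ (b - e j) = 0) :
    dividedDiff (jackPoles e b (Finset.range n)) (jackNum θ e b n * f) =
      θ * (1 - θ) * (∑ i ∈ Finset.range n,
        ((∏ j ∈ (Finset.range n).erase i, rowFactor θ (e i - e j)) *
          ((e i - b + 1 - θ) / (e i - b)) * f.eval (e i) -
        (∏ j ∈ (Finset.range n).erase i, rowFactor θ (e i - 1 - e j)) *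
          ((e i - 1 - b + 1 - θ) / (e i - 1 - b)) * f.eval (e i - 1))) := by
  rw [dividedDiff, h.sum _ _ subset_rfl, Finset.mul_sum]
  have h0 : (jackNum θ e b n * f).eval b = 0 := by
    obtain ⟨j, hj, hj0⟩ := hb
    have h1 : b - e j ≠ 0 := sub_ne_zero.2 (h.left j hj).symm
    have h2 : b - e j + 1 ≠ 0 := fun h' => h.right j hj (by linarith)
    rw [rowFactor, div_eq_zero_iff, or_iff_left (mul_ne_zero h1 h2)] at hj0
    simp only [jackNum, Polynomial.eval_mul, Polynomial.eval_prod, Polynomial.eval_sub,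
      Polynomial.eval_X, Polynomial.eval_C]
    rw [Finset.prod_eq_zero (Finset.mem_range.2 hj) (by rw [← hj0]; ring)]
    ring
  rw [h0, zero_div, zero_add]
  refine Finset.sum_congr rfl fun i hi => ?_
  have hi' := Finset.mem_range.1 hi
  have hsub : (Finset.range n).erase i ⊆ Finset.range n := Finset.erase_subset _ _
  obtain ⟨m1, m2⟩ := h.notMem hi' hsub (Finset.notMem_erase i _)
  have hS : jackPoles e b (Finset.range n) =
      insert (e i) (insert (e i - 1) (jackPoles e b ((Finset.range n).erase i))) := by
    rw [← jackPoles_insert, Finset.insert_erase hi]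
  have m3 : e i ∉ jackPoles e b ((Finset.range n).erase i) :=
    fun h => m2 (Finset.mem_insert_of_mem h)
  have m4 : e i - 1 ∉ insert (e i) (jackPoles e b ((Finset.range n).erase i)) := by
    simp only [Finset.mem_insert, not_or]
    exact ⟨by linarith, m1⟩
  have E1 : (jackPoles e b (Finset.range n)).erase (e i) =
      insert (e i - 1) (jackPoles e b ((Finset.range n).erase i)) := by
    rw [hS, Finset.erase_insert m2]
  have E2 : (jackPoles e b (Finset.range n)).erase (e i - 1) =
      insert (e i) (jackPoles e b ((Finset.range n).erase i)) := by
    rw [hS, Finset.insert_comm, Finset.erase_insert m4]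
  rw [E1, E2, Finset.prod_insert m1, Finset.prod_insert m3, h.prod (fun r => e i - r) _ hsub,
    h.prod (fun r => e i - 1 - r) _ hsub]
  have hN : ∀ x : ℝ, (jackNum θ e b n * f).eval x =
      (x - b + 1 - θ) * ((x - e i + θ) * (x - e i + 1 - θ) *
        ∏ j ∈ (Finset.range n).erase i, ((x - e j + θ) * (x - e j + 1 - θ))) * f.eval x := by
    intro x
    rw [Finset.mul_prod_erase _ (fun j => (x - e j + θ) * (x - e j + 1 - θ)) hi]
    simp only [jackNum, Polynomial.eval_mul, Polynomial.eval_prod, Polynomial.eval_sub,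
      Polynomial.eval_X, Polynomial.eval_C]
    congr 2
    · ring
    · exact Finset.prod_congr rfl fun j _ => by ring
  have hR : ∀ x : ℝ, ∏ j ∈ (Finset.range n).erase i, rowFactor θ (x - e j) =
      (∏ j ∈ (Finset.range n).erase i, ((x - e j + θ) * (x - e j + 1 - θ))) /
        ∏ j ∈ (Finset.range n).erase i, ((x - e j) * (x - (e j - 1))) := by
    intro x
    rw [← Finset.prod_div_distrib]
    refine Finset.prod_congr rfl fun j _ => ?_
    rw [rowFactor]; congr 2; ring
  rw [hN, hN, hR, hR]
  generalize ∏ j ∈ (Finset.range n).erase i, ((e i - e j) * (e i - (e j - 1))) = A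
  generalize ∏ j ∈ (Finset.range n).erase i, ((e i - 1 - e j) * (e i - 1 - (e j - 1))) = B
  generalize ∏ j ∈ (Finset.range n).erase i, ((e i - e j + θ) * (e i - e j + 1 - θ)) = A'
  generalize ∏ j ∈ (Finset.range n).erase i, ((e i - 1 - e j + θ) * (e i - 1 - e j + 1 - θ)) = B'
  have q1 : e i - (e i - 1) = 1 := by ring
  have q2 : e i - 1 - e i = -1 := by ring
  rw [q1, q2, one_mul, sub_self, mul_sub]
  simp only [div_eq_mul_inv, mul_inv]
  norm_num
  ring

/-! ### Edges of the Young graph -/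

/-- `ν` is obtained from `μ` by adding a box at the end of row `i`. -/
def EdgeAt (μ ν : YoungDiagram) (i : ℕ) : Prop :=
  ν.cells = insert (i, μ.rowLen i) μ.cells

/-- Row `i` of `μ` can be extended by a box. -/
def Addable (μ : YoungDiagram) (i : ℕ) : Prop :=
  ∀ k < i, μ.rowLen i < μ.rowLen k

/-- The last box of row `i` of `ν` can be removed. -/
def Removable (ν : YoungDiagram) (i : ℕ) : Prop :=
  ∀ k > i, ν.rowLen k < ν.rowLen i

theorem notMem_rowEnd (μ : YoungDiagram) (i : ℕ) : (i, μ.rowLen i) ∉ μ.cells := by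
  rw [YoungDiagram.mem_cells, YoungDiagram.mem_iff_lt_rowLen]; omega

theorem rowLen_eq_of_forall {μ : YoungDiagram} {i m : ℕ} (h : ∀ j, (i, j) ∈ μ ↔ j < m) :
    μ.rowLen i = m := by
  by_contra hne
  rcases lt_or_gt_of_ne hne with h' | h'
  · have := YoungDiagram.mem_iff_lt_rowLen.1 ((h _).2 h'); omega
  · have := (h _).1 (YoungDiagram.mem_iff_lt_rowLen.2 h'); omega

theorem colLen_eq_of_forall {μ : YoungDiagram} {j m : ℕ} (h : ∀ i, (i, j) ∈ μ ↔ i < m) :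
    μ.colLen j = m := by
  by_contra hne
  rcases lt_or_gt_of_ne hne with h' | h'
  · have := YoungDiagram.mem_iff_lt_colLen.1 ((h _).2 h'); omega
  · have := (h _).1 (YoungDiagram.mem_iff_lt_colLen.2 h'); omega

namespace EdgeAt

variable {μ ν : YoungDiagram} {i : ℕ}

theorem mem (h : EdgeAt μ ν i) {x : ℕ × ℕ} : x ∈ ν ↔ x = (i, μ.rowLen i) ∨ x ∈ μ := by
  rw [← YoungDiagram.mem_cells, h, Finset.mem_insert, YoungDiagram.mem_cells]

theorem card_eq (h : EdgeAt μ ν i) : ν.card = μ.card + 1 := by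
  rw [YoungDiagram.card, h, Finset.card_insert_of_notMem (notMem_rowEnd μ i)]

theorem edge (h : EdgeAt μ ν i) : Edge μ ν :=
  ⟨YoungDiagram.cells_subset_iff.1 (h ▸ Finset.subset_insert _ _), h.card_eq⟩

theorem newBox_eq (h : EdgeAt μ ν i) : newBox μ ν = (i, μ.rowLen i) := by
  have : ν.cells \ μ.cells = {(i, μ.rowLen i)} := by
    rw [h, Finset.insert_sdiff_of_notMem _ (notMem_rowEnd μ i), sdiff_self]; rfl
  rw [newBox, this, Finset.sum_singleton]

theorem addable (h : EdgeAt μ ν i) : Addable μ i := by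
  intro k hk
  have h1 : (k, μ.rowLen i) ∈ ν := ν.up_left_mem hk.le le_rfl (h.mem.2 (Or.inl rfl))
  rcases h.mem.1 h1 with h2 | h2
  · have := congrArg Prod.fst h2; simp at this; omega
  · exact YoungDiagram.mem_iff_lt_rowLen.1 h2

theorem rowLen_self (h : EdgeAt μ ν i) : ν.rowLen i = μ.rowLen i + 1 :=
  rowLen_eq_of_forall fun j => by
    rw [h.mem, YoungDiagram.mem_iff_lt_rowLen, Prod.mk.injEq]; omega

theorem rowLen_of_ne (h : EdgeAt μ ν i) {k : ℕ} (hk : k ≠ i) : ν.rowLen k = μ.rowLen k :=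
  rowLen_eq_of_forall fun j => by
    rw [h.mem, YoungDiagram.mem_iff_lt_rowLen, Prod.mk.injEq]; omega

theorem colLen_lower (h : EdgeAt μ ν i) : μ.colLen (μ.rowLen i) = i :=
  colLen_eq_of_forall fun k => by
    rw [YoungDiagram.mem_iff_lt_rowLen]
    refine ⟨fun hk => ?_, fun hk => h.addable k hk⟩
    by_contra hc
    have := μ.rowLen_anti i k (by omega)
    omega

theorem colLen_upper (h : EdgeAt μ ν i) : ν.colLen (μ.rowLen i) = i + 1 :=
  colLen_eq_of_forall fun k => by
    rw [h.mem, YoungDiagram.mem_iff_lt_colLen, h.colLen_lower, Prod.mk.injEq]; omega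

theorem colLen_of_ne (h : EdgeAt μ ν i) {j : ℕ} (hj : j ≠ μ.rowLen i) : ν.colLen j = μ.colLen j :=
  colLen_eq_of_forall fun k => by
    rw [h.mem, YoungDiagram.mem_iff_lt_colLen, Prod.mk.injEq]; omega

theorem removable (h : EdgeAt μ ν i) : Removable ν i := by
  intro k hk
  rw [h.rowLen_self, h.rowLen_of_ne (by omega)]
  have := μ.rowLen_anti i k (by omega)
  omega

theorem unique_upper {ν' : YoungDiagram} (h : EdgeAt μ ν i) (h' : EdgeAt μ ν' i) : ν = ν' :=
  YoungDiagram.ext (h.trans h'.symm)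

theorem unique_lower {μ' : YoungDiagram} (h : EdgeAt μ ν i) (h' : EdgeAt μ' ν i) : μ = μ' := by
  have e : μ.rowLen i = μ'.rowLen i := by
    have := h.rowLen_self; have := h'.rowLen_self; omega
  apply YoungDiagram.ext
  have a1 : ν.cells.erase (i, μ.rowLen i) = μ.cells := by
    rw [h, Finset.erase_insert (notMem_rowEnd μ i)]
  have a2 : ν.cells.erase (i, μ'.rowLen i) = μ'.cells := by
    rw [h', Finset.erase_insert (notMem_rowEnd μ' i)]
  rw [← a1, e, a2]

theorem unique_row {i' : ℕ} (h : EdgeAt μ ν i) (h' : EdgeAt μ ν i') : i = i' := by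
  have := h.newBox_eq.symm.trans h'.newBox_eq
  exact congrArg Prod.fst this

end EdgeAt

theorem Edge.exists_edgeAt {μ ν : YoungDiagram} (h : Edge μ ν) : ∃ i, EdgeAt μ ν i := by
  obtain ⟨hle, hcard⟩ := h
  have hsub := YoungDiagram.cells_subset_iff.2 hle
  have h1 : (ν.cells \ μ.cells).card = 1 := by
    rw [Finset.card_sdiff_of_subset hsub]
    have : ν.cells.card = μ.cells.card + 1 := hcard
    omega
  obtain ⟨⟨i, j⟩, hx⟩ := Finset.card_eq_one.1 h1
  have hm : ∀ y, y ∈ ν ↔ y ∈ μ ∨ y = (i, j) := by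
    intro y
    have h2 : y ∈ ν.cells \ μ.cells ↔ y = (i, j) := by rw [hx, Finset.mem_singleton]
    rw [Finset.mem_sdiff, YoungDiagram.mem_cells, YoungDiagram.mem_cells] at h2
    have h3 : y ∈ μ → y ∈ ν := fun hy => hle hy
    tauto
  have hnot : (i, j) ∉ μ := by
    have : (i, j) ∈ ν.cells \ μ.cells := by rw [hx]; simp
    simpa using (Finset.mem_sdiff.1 this).2
  have hj : μ.rowLen i = j := by
    have h4 : ¬ j < μ.rowLen i := fun h => hnot (YoungDiagram.mem_iff_lt_rowLen.2 h)
    by_contra hne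
    have h5 : (i, μ.rowLen i) ∈ ν :=
      ν.up_left_mem le_rfl (by omega) ((hm (i, j)).2 (Or.inr rfl))
    rcases (hm _).1 h5 with h6 | h6
    · exact absurd (YoungDiagram.mem_iff_lt_rowLen.1 h6) (lt_irrefl _)
    · exact hne (congrArg Prod.snd h6)
  refine ⟨i, ?_⟩
  ext y
  rw [Finset.mem_insert, YoungDiagram.mem_cells, YoungDiagram.mem_cells, hm, hj]
  tauto

theorem Addable.exists_edgeAt {μ : YoungDiagram} {i : ℕ} (h : Addable μ i) :
    ∃ ν, EdgeAt μ ν i := by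
  refine ⟨⟨insert (i, μ.rowLen i) μ.cells, ?_⟩, rfl⟩
  rintro ⟨a, b⟩ ⟨c, d⟩ hle hmem
  obtain ⟨hc, hd⟩ : c ≤ a ∧ d ≤ b := hle
  simp only [Finset.coe_insert, Set.mem_insert_iff, Prod.mk.injEq, Finset.mem_coe,
    YoungDiagram.mem_cells, YoungDiagram.mem_iff_lt_rowLen] at hmem ⊢
  rcases hmem with ⟨rfl, rfl⟩ | hmem
  · rcases eq_or_lt_of_le hc with rfl | hc
    · omega
    · have := h c hc; omega
  · have := μ.rowLen_anti c a hc; omega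

theorem Removable.exists_edgeAt {ν : YoungDiagram} {i : ℕ} (h : Removable ν i) :
    ∃ μ, EdgeAt μ ν i := by
  have hpos : 0 < ν.rowLen i := (Nat.zero_le _).trans_lt (h (i + 1) (by omega))
  let μ : YoungDiagram := ⟨ν.cells.erase (i, ν.rowLen i - 1), by
    rintro ⟨a, b⟩ ⟨c, d⟩ hle hmem
    obtain ⟨hc, hd⟩ : c ≤ a ∧ d ≤ b := hle
    simp only [Finset.coe_erase, Set.mem_sdiff, Finset.mem_coe, YoungDiagram.mem_cells,
      YoungDiagram.mem_iff_lt_rowLen, Set.mem_singleton_iff, Prod.mk.injEq] at hmem ⊢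
    have h1 := ν.rowLen_anti c a hc
    refine ⟨by omega, ?_⟩
    rintro ⟨rfl, rfl⟩
    rcases eq_or_lt_of_le hc with rfl | hc
    · omega
    · have := h a hc; omega⟩
  have hμ : μ.rowLen i = ν.rowLen i - 1 := rowLen_eq_of_forall fun j => by
    change (i, j) ∈ ν.cells.erase (i, ν.rowLen i - 1) ↔ _
    rw [Finset.mem_erase, YoungDiagram.mem_cells, YoungDiagram.mem_iff_lt_rowLen, Ne,
      Prod.mk.injEq]
    omega
  refine ⟨μ, ?_⟩
  rw [EdgeAt, hμ]
  change _ = insert _ (ν.cells.erase (i, ν.rowLen i - 1))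
  rw [Finset.insert_erase]
  rw [YoungDiagram.mem_cells, YoungDiagram.mem_iff_lt_rowLen]; omega

open Classical in
/-- `μ` with a box added to row `i`; `μ` itself if row `i` is not addable. -/
noncomputable def addBox (μ : YoungDiagram) (i : ℕ) : YoungDiagram :=
  if h : Addable μ i then h.exists_edgeAt.choose else μ

open Classical in
/-- `ν` with a box removed from row `i`; `ν` itself if row `i` is not removable. -/
noncomputable def removeBox (ν : YoungDiagram) (i : ℕ) : YoungDiagram :=
  if h : Removable ν i then h.exists_edgeAt.choose else ν

theorem Addable.edgeAt {μ : YoungDiagram} {i : ℕ} (h : Addable μ i) : EdgeAt μ (addBox μ i) i := by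
  rw [addBox, dif_pos h]; exact h.exists_edgeAt.choose_spec

theorem Removable.edgeAt {ν : YoungDiagram} {i : ℕ} (h : Removable ν i) :
    EdgeAt (removeBox ν i) ν i := by
  rw [removeBox, dif_pos h]; exact h.exists_edgeAt.choose_spec

theorem rowLen_card (μ : YoungDiagram) : μ.rowLen μ.card = 0 := by
  have h1 : μ.colLen 0 ≤ μ.card := by
    rw [YoungDiagram.colLen_eq_card]
    exact Finset.card_le_card (Finset.filter_subset _ _)
  by_contra h
  have := YoungDiagram.mem_iff_lt_colLen.1
    (YoungDiagram.mem_iff_lt_rowLen.2 (Nat.pos_of_ne_zero h))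
  omega

theorem rowLen_eq_zero_of_le {μ : YoungDiagram} {m k : ℕ} (h : μ.rowLen m = 0) (hk : m ≤ k) :
    μ.rowLen k = 0 := by
  have := μ.rowLen_anti m k hk; omega

theorem sum_rowLen {μ : YoungDiagram} {m : ℕ} (h : μ.rowLen m = 0) :
    ∑ i ∈ Finset.range m, μ.rowLen i = μ.card := by
  have : ∀ x ∈ μ.cells, x.1 ∈ Finset.range m := by
    rintro ⟨i, j⟩ hx
    rw [YoungDiagram.mem_cells, YoungDiagram.mem_iff_lt_rowLen] at hx
    rw [Finset.mem_range]
    by_contra hc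
    have := rowLen_eq_zero_of_le h (k := i) (by simpa using hc)
    omega
  rw [YoungDiagram.card, Finset.card_eq_sum_card_fiberwise this]
  exact Finset.sum_congr rfl fun i _ => by rw [YoungDiagram.rowLen_eq_card]; rfl

theorem Addable.le_of_rowLen {μ : YoungDiagram} {i m : ℕ} (h : Addable μ i) (hm : μ.rowLen m = 0) :
    i ≤ m := by
  by_contra hc
  have := h m (by omega)
  omega

theorem Removable.lt_of_rowLen {ν : YoungDiagram} {i m : ℕ} (h : Removable ν i)
    (hm : ν.rowLen m = 0) : i < m := by
  by_contra hc
  have := rowLen_eq_zero_of_le hm (k := i) (by omega)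
  have := h (i + 1) (by omega)
  omega

open Classical in
/-- The diagrams obtained by adding a box to `μ`. -/
noncomputable def upNbrs (μ : YoungDiagram) : Finset YoungDiagram :=
  ((Finset.range (μ.card + 1)).filter (Addable μ)).image (addBox μ)

open Classical in
/-- The diagrams obtained by removing a box from `ν`. -/
noncomputable def downNbrs (ν : YoungDiagram) : Finset YoungDiagram :=
  ((Finset.range (ν.card + 1)).filter (Removable ν)).image (removeBox ν)

theorem mem_upNbrs {μ ν : YoungDiagram} : ν ∈ upNbrs μ ↔ Edge μ ν := by
  classical
  simp only [upNbrs, Finset.mem_image, Finset.mem_filter, Finset.mem_range]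
  constructor
  · rintro ⟨i, ⟨-, hi⟩, rfl⟩; exact hi.edgeAt.edge
  · intro h
    obtain ⟨i, hi⟩ := h.exists_edgeAt
    exact ⟨i, ⟨Nat.lt_succ_of_le (hi.addable.le_of_rowLen (rowLen_card μ)), hi.addable⟩,
      hi.addable.edgeAt.unique_upper hi⟩

theorem mem_downNbrs {μ ν : YoungDiagram} : μ ∈ downNbrs ν ↔ Edge μ ν := by
  classical
  simp only [downNbrs, Finset.mem_image, Finset.mem_filter, Finset.mem_range]
  constructor
  · rintro ⟨i, ⟨-, hi⟩, rfl⟩; exact hi.edgeAt.edge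
  · intro h
    obtain ⟨i, hi⟩ := h.exists_edgeAt
    exact ⟨i, ⟨(hi.removable.lt_of_rowLen (rowLen_card ν)).trans (Nat.lt_succ_self _), hi.removable⟩,
      hi.removable.edgeAt.unique_lower hi⟩

open Classical in
theorem sum_upNbrs {E : Type*} [AddCommMonoid E] (μ : YoungDiagram) (f : YoungDiagram → E) :
    ∑ ν ∈ upNbrs μ, f ν =
      ∑ i ∈ Finset.range (μ.card + 1), if Addable μ i then f (addBox μ i) else 0 := by
  rw [upNbrs, Finset.sum_image, Finset.sum_filter]
  intro i hi j hj hij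
  simp only [Finset.coe_filter, Set.mem_ofPred_eq] at hi hj
  exact hi.2.edgeAt.unique_row (hij ▸ hj.2.edgeAt)

open Classical in
theorem sum_downNbrs {E : Type*} [AddCommMonoid E] (ν : YoungDiagram) (f : YoungDiagram → E) :
    ∑ μ ∈ downNbrs ν, f μ =
      ∑ i ∈ Finset.range (ν.card + 1), if Removable ν i then f (removeBox ν i) else 0 := by
  rw [downNbrs, Finset.sum_image, Finset.sum_filter]
  intro i hi j hj hij
  simp only [Finset.coe_filter, Set.mem_ofPred_eq] at hi hj
  have h1 := hi.2.edgeAt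
  have h2 := hj.2.edgeAt
  rw [← hij] at h2
  exact h1.unique_row h2

/-! ### The edge weights in terms of row contents -/

/-- The weight `κ_θ κ*_θ` of an edge, the square of the self-dual multiplicity. -/
noncomputable def edgeWeight (θ : ℝ) (μ ν : YoungDiagram) : ℝ :=
  jackMult θ μ ν * jackMultDual θ μ ν

/-- The content of the first box to the right of row `i`. -/
noncomputable def rowContent (θ : ℝ) (μ : YoungDiagram) (i : ℕ) : ℝ :=
  μ.rowLen i - θ * i

/-- The row form of an edge weight: rows `0, …, M - 1` other than `i` contribute a factor each, and
the empty rows from `M` on contribute, by telescoping, the last factor. -/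
noncomputable def rowWeight (θ : ℝ) (e : ℕ → ℝ) (M i : ℕ) (x : ℝ) : ℝ :=
  (∏ k ∈ (Finset.range M).erase i, rowFactor θ (x - e k)) *
    ((x - -(θ * M) + 1 - θ) / (x - -(θ * M)))

theorem F_pos {θ a l : ℝ} (hθ : 0 < θ) (ha : 0 ≤ a) (hl : 0 ≤ l) : 0 < F θ a l := by
  unfold F; positivity

theorem F_above (θ c r i k : ℝ) :
    F θ (r - c - 1) (i - k - 1) = rowFactor θ (c - θ * i - (r - θ * k)) := by
  unfold F rowFactor; congr 1 <;> ring

theorem F_below (θ c r i k : ℝ) :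
    F θ (c - r) k = rowFactor θ (c - θ * i - (r - θ * (i + 1 + k))) := by
  unfold F rowFactor; congr 1 <;> ring

theorem prod_F_telescope {θ c : ℝ} (hθ : 0 < θ) (hc : 0 ≤ c) (K n : ℕ) :
    ∏ k ∈ Finset.range n, F θ c ((K + k : ℕ) : ℝ) =
      (c + 1 + θ * K) / (c + θ * (K + 1)) *
        ((c + θ * (K + n + 1)) / (c + 1 + θ * (K + n))) := by
  induction n with
  | zero =>
    have h1 : c + 1 + θ * K ≠ 0 := by positivity
    have h2 : c + θ * (K + 1) ≠ 0 := by positivity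
    simp only [Finset.range_zero, Finset.prod_empty, Nat.cast_zero, add_zero]
    field_simp
  | succ n ih =>
    have h1 : c + 1 + θ * (K + n) ≠ 0 := by positivity
    have h2 : c + θ * (K + 1) ≠ 0 := by positivity
    have h3 : c + 1 + θ * (K + n + 1) ≠ 0 := by positivity
    have h4 : c + θ * (K + n + 1) ≠ 0 := by positivity
    rw [Finset.prod_range_succ, ih, F]
    push_cast
    rw [show c + θ * (K + n + 2 : ℝ) = c + θ * (K + (n + 1) + 1) by ring,
      show c + 1 + θ * (K + (n + 1) : ℝ) = c + 1 + θ * (K + n + 1) by ring]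
    field_simp

theorem tendsto_prod_F {θ c : ℝ} (hθ : 0 < θ) (hc : 0 ≤ c) (K : ℕ) :
    Tendsto (fun n => ∏ k ∈ Finset.range n, F θ c ((K + k : ℕ) : ℝ)) atTop
      (𝓝 ((c + 1 + θ * K) / (c + θ * (K + 1)))) := by
  simp only [prod_F_telescope hθ hc]
  have h1 : Tendsto (fun n : ℕ => c + 1 + θ * ((K : ℝ) + n)) atTop atTop := by
    refine tendsto_atTop_add_const_left _ _ (Tendsto.const_mul_atTop hθ ?_)
    exact tendsto_atTop_add_const_left _ _ tendsto_natCast_atTop_atTop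
  have h2 : Tendsto (fun n : ℕ => 1 + (θ - 1) * (c + 1 + θ * ((K : ℝ) + n))⁻¹) atTop
      (𝓝 (1 + (θ - 1) * 0)) := (h1.inv_tendsto_atTop.const_mul _).const_add _
  have h3 : ∀ n : ℕ, (c + θ * (K + n + 1)) / (c + 1 + θ * (K + n)) =
      1 + (θ - 1) * (c + 1 + θ * ((K : ℝ) + n))⁻¹ := by
    intro n
    have : c + 1 + θ * ((K : ℝ) + n) ≠ 0 := by positivity
    field_simp; ring
  simp only [h3]
  simpa using h2.const_mul ((c + 1 + θ * K) / (c + θ * (K + 1)))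

/-- For `k ≥ K` the factors are `1 + θ (1 - θ) / ((c + θ (k + 1)) (c + 1 + θ (k + 1)))`. -/
theorem multipliable_F {θ c : ℝ} (hθ : 0 < θ) (hc : 0 ≤ c) (m : ℕ → ℝ) (K : ℕ)
    (hm : ∀ k, m (K + k) = 0) : Multipliable fun k : ℕ => F θ (c - m k) k := by
  have h : Summable fun k : ℕ => F θ (c - m k) k - 1 := by
    rw [← summable_nat_add_iff K]
    have hs : Summable fun k : ℕ => |θ * (1 - θ)| / θ ^ 2 * (1 / ((k : ℝ) + 1) ^ 2) := by
      refine Summable.mul_left _ ?_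
      exact_mod_cast (summable_nat_add_iff 1).2 (Real.summable_one_div_nat_pow.2 one_lt_two)
    refine hs.of_norm_bounded fun k => ?_
    rw [show k + K = K + k by ring, hm, sub_zero, F]
    have h1 : 0 < c + θ * (((K + k : ℕ) : ℝ) + 1) := by positivity
    have h2 : 0 < c + 1 + θ * (((K + k : ℕ) : ℝ) + 1) := by positivity
    have h3 : (c + θ * (((K + k : ℕ) : ℝ) + 2)) * (c + 1 + θ * ((K + k : ℕ) : ℝ)) /
        ((c + θ * (((K + k : ℕ) : ℝ) + 1)) * (c + 1 + θ * (((K + k : ℕ) : ℝ) + 1))) - 1 =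
        θ * (1 - θ) / ((c + θ * (((K + k : ℕ) : ℝ) + 1)) *
          (c + 1 + θ * (((K + k : ℕ) : ℝ) + 1))) := by
      field_simp; ring
    have h4 : θ * ((k : ℝ) + 1) ≤ c + θ * (((K + k : ℕ) : ℝ) + 1) := by
      push_cast; nlinarith [mul_nonneg hθ.le (Nat.cast_nonneg (α := ℝ) K)]
    have h5 : (0 : ℝ) < θ * (k + 1) := by positivity
    rw [h3, Real.norm_eq_abs, abs_div, abs_of_pos (mul_pos h1 h2), div_mul_div_comm, mul_one,
      ← mul_pow]
    refine div_le_div_of_nonneg_left (abs_nonneg _) (by positivity) ?_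
    rw [pow_two]
    exact mul_le_mul h4 (by linarith) h5.le h1.le
  simpa using Real.multipliable_one_add_of_summable h

theorem tprod_F {θ c : ℝ} (hθ : 0 < θ) (hc : 0 ≤ c) (m : ℕ → ℝ) (K : ℕ)
    (hm : ∀ k, m (K + k) = 0) :
    ∏' k : ℕ, F θ (c - m k) k =
      (∏ k ∈ Finset.range K, F θ (c - m k) k) * ((c + 1 + θ * K) / (c + θ * (K + 1))) := by
  have h1 := (multipliable_F hθ hc m K hm).hasProd.tendsto_prod_nat
  have h2 := (tendsto_add_atTop_iff_nat K).2 h1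
  refine tendsto_nhds_unique h2 ?_
  have h3 : (fun n => ∏ k ∈ Finset.range (n + K), F θ (c - m k) k) = fun n =>
      (∏ k ∈ Finset.range K, F θ (c - m k) k) *
        ∏ k ∈ Finset.range n, F θ c ((K + k : ℕ) : ℝ) := by
    funext n
    rw [add_comm n K, Finset.prod_range_add]
    simp only [hm, sub_zero]
  rw [h3]
  exact (tendsto_prod_F hθ hc K).const_mul _

namespace EdgeAt

variable {μ ν : YoungDiagram} {i : ℕ}

theorem jackMult_eq (h : EdgeAt μ ν i) (θ : ℝ) : jackMult θ μ ν =
    ∏ k ∈ Finset.range i, F θ ((μ.rowLen k : ℝ) - μ.rowLen i - 1) ((i : ℝ) - k - 1) := by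
  rw [jackMult, h.newBox_eq]
  simp only [h.colLen_lower]

theorem jackMultDual_eq (h : EdgeAt μ ν i) {θ : ℝ} (hθ : 0 < θ) (K : ℕ)
    (hK : μ.rowLen (i + 1 + K) = 0) : jackMultDual θ μ ν =
    (∏ k ∈ Finset.range K, F θ ((μ.rowLen i : ℝ) - μ.rowLen (i + 1 + k)) k) *
      ((μ.rowLen i + 1 + θ * K) / (μ.rowLen i + θ * (K + 1))) := by
  rw [jackMultDual, h.newBox_eq]
  simp only [h.colLen_upper]
  rw [← tprod_F hθ (Nat.cast_nonneg _) (fun k => (μ.rowLen (i + 1 + k) : ℝ)) K]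
  · refine tprod_congr fun k => ?_
    rw [h.rowLen_of_ne (by omega)]
  · intro k
    rw [rowLen_eq_zero_of_le hK (by omega), Nat.cast_zero]

theorem jackMult_pos (h : EdgeAt μ ν i) {θ : ℝ} (hθ : 0 < θ) : 0 < jackMult θ μ ν := by
  rw [h.jackMult_eq]
  refine Finset.prod_pos fun k hk => ?_
  have hk' := Finset.mem_range.1 hk
  have h1 : (μ.rowLen i : ℝ) + 1 ≤ μ.rowLen k := by exact_mod_cast h.addable k hk'
  have h2 : (k : ℝ) + 1 ≤ i := by exact_mod_cast hk'
  exact F_pos hθ (by linarith) (by linarith)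

theorem jackMultDual_pos (h : EdgeAt μ ν i) {θ : ℝ} (hθ : 0 < θ) : 0 < jackMultDual θ μ ν := by
  rw [h.jackMultDual_eq hθ μ.card (rowLen_eq_zero_of_le (rowLen_card μ) (by omega))]
  refine mul_pos (Finset.prod_pos fun k _ => ?_) (by positivity)
  have h1 : (μ.rowLen (i + 1 + k) : ℝ) ≤ μ.rowLen i := by
    exact_mod_cast μ.rowLen_anti _ _ (by omega)
  exact F_pos hθ (by linarith) (by positivity)

theorem edgeWeight_pos (h : EdgeAt μ ν i) {θ : ℝ} (hθ : 0 < θ) : 0 < edgeWeight θ μ ν :=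
  mul_pos (h.jackMult_pos hθ) (h.jackMultDual_pos hθ)

/-- The weight of an edge in terms of the row contents of its lower end. -/
theorem edgeWeight_lower (h : EdgeAt μ ν i) {θ : ℝ} (hθ : 0 < θ) {M : ℕ} (hi : i < M)
    (hM : μ.rowLen M = 0) :
    edgeWeight θ μ ν = rowWeight θ (rowContent θ μ) M i (rowContent θ μ i) := by
  obtain ⟨K, rfl⟩ : ∃ K, M = i + 1 + K := ⟨M - (i + 1), by omega⟩
  rw [edgeWeight, h.jackMult_eq, h.jackMultDual_eq hθ K hM, rowWeight, ← mul_assoc]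
  congr 1
  · have h1 : ∏ k ∈ (Finset.range (i + 1 + K)).erase i,
        rowFactor θ (rowContent θ μ i - rowContent θ μ k) =
        ∏ k ∈ Finset.range (i + 1 + K),
          if k = i then 1 else rowFactor θ (rowContent θ μ i - rowContent θ μ k) := by
      rw [← Finset.mul_prod_erase (Finset.range (i + 1 + K)) _ (a := i) (Finset.mem_range.2 hi), if_pos rfl,
        one_mul]
      exact Finset.prod_congr rfl fun k hk => by rw [if_neg (Finset.ne_of_mem_erase hk)]
    rw [h1, Finset.prod_range_add, Finset.prod_range_succ, if_pos rfl, mul_one]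
    congr 1
    · refine Finset.prod_congr rfl fun k hk => ?_
      have := Finset.mem_range.1 hk
      rw [if_neg (by omega), F_above]
      rfl
    · refine Finset.prod_congr rfl fun k hk => ?_
      rw [if_neg (by omega), F_below θ _ _ i]
      simp only [rowContent]
      push_cast
      rfl
  · simp only [rowContent]
    push_cast
    congr 1 <;> ring

theorem rowContent_self (h : EdgeAt μ ν i) (θ : ℝ) :
    rowContent θ ν i = rowContent θ μ i + 1 := by
  rw [rowContent, rowContent, h.rowLen_self]; push_cast; ring

theorem rowContent_of_ne (h : EdgeAt μ ν i) (θ : ℝ) {k : ℕ} (hk : k ≠ i) :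
    rowContent θ ν k = rowContent θ μ k := by
  rw [rowContent, rowContent, h.rowLen_of_ne hk]

/-- The weight of an edge in terms of the row contents of its upper end. -/
theorem edgeWeight_upper (h : EdgeAt μ ν i) {θ : ℝ} (hθ : 0 < θ) {M : ℕ} (hi : i < M)
    (hM : ν.rowLen M = 0) :
    edgeWeight θ μ ν = rowWeight θ (rowContent θ ν) M i (rowContent θ ν i - 1) := by
  have hM' : μ.rowLen M = 0 := by rw [← h.rowLen_of_ne (by omega), hM]
  rw [h.edgeWeight_lower hθ hi hM', rowWeight, rowWeight, h.rowContent_self, add_sub_cancel_right]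
  congr 1
  exact Finset.prod_congr rfl fun k hk => by rw [h.rowContent_of_ne θ (Finset.ne_of_mem_erase hk)]

end EdgeAt

/-- The symmetry of `rowFactor` behind the equality of the products of weights around a square. -/
theorem rowFactor_neg (θ u : ℝ) : rowFactor θ (-u) = rowFactor θ (u - 1) := by
  unfold rowFactor; congr 1 <;> ring

/-- Around a square of the Young graph, the products of the weights of the two upper and of the two
lower edges agree. -/
theorem edgeWeight_square {θ : ℝ} (hθ : 0 < θ) {μ lam ν ρ : YoungDiagram} {i j : ℕ} (hij : i ≠ j)
    (h1 : EdgeAt μ lam i) (h2 : EdgeAt μ ν j) (h3 : EdgeAt lam ρ j) (h4 : EdgeAt ν ρ i) :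
    edgeWeight θ lam ρ * edgeWeight θ ν ρ = edgeWeight θ μ lam * edgeWeight θ μ ν := by
  obtain ⟨M, hi, hj, hM⟩ : ∃ M, i < M ∧ j < M ∧ μ.rowLen M = 0 :=
    ⟨μ.card + i + j + 1, by omega, by omega, rowLen_eq_zero_of_le (rowLen_card μ) (by omega)⟩
  have hl : lam.rowLen M = 0 := by rw [h1.rowLen_of_ne (by omega), hM]
  have hn : ν.rowLen M = 0 := by rw [h2.rowLen_of_ne (by omega), hM]
  rw [h1.edgeWeight_lower hθ hi hM, h2.edgeWeight_lower hθ hj hM, h3.edgeWeight_lower hθ hj hl,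
    h4.edgeWeight_lower hθ hi hn]
  simp only [rowWeight]
  have mi : i ∈ (Finset.range M).erase j := Finset.mem_erase.2 ⟨hij, Finset.mem_range.2 hi⟩
  have mj : j ∈ (Finset.range M).erase i := Finset.mem_erase.2 ⟨hij.symm, Finset.mem_range.2 hj⟩
  rw [← Finset.mul_prod_erase _ _ mi, ← Finset.mul_prod_erase _ _ mj,
    ← Finset.mul_prod_erase _ _ mi, ← Finset.mul_prod_erase _ _ mj,
    h1.rowContent_of_ne θ hij.symm, h2.rowContent_of_ne θ hij, h1.rowContent_self,
    h2.rowContent_self]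
  have e1 : ∏ k ∈ ((Finset.range M).erase j).erase i,
      rowFactor θ (rowContent θ μ j - rowContent θ lam k) =
      ∏ k ∈ ((Finset.range M).erase j).erase i,
      rowFactor θ (rowContent θ μ j - rowContent θ μ k) :=
    Finset.prod_congr rfl fun k hk => by rw [h1.rowContent_of_ne θ (Finset.ne_of_mem_erase hk)]
  have e2 : ∏ k ∈ ((Finset.range M).erase i).erase j,
      rowFactor θ (rowContent θ μ i - rowContent θ ν k) =
      ∏ k ∈ ((Finset.range M).erase i).erase j,
      rowFactor θ (rowContent θ μ i - rowContent θ μ k) :=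
    Finset.prod_congr rfl fun k hk => by rw [h2.rowContent_of_ne θ (Finset.ne_of_mem_erase hk)]
  rw [e1, e2, ← sub_sub, ← sub_sub, ← rowFactor_neg, ← rowFactor_neg, neg_sub, neg_sub]
  ring

/-! ### Moments of the edge weights at a diagram -/

/-- The content of a box, as a real number. -/
noncomputable def boxContent (θ : ℝ) (x : ℕ × ℕ) : ℝ :=
  x.2 - θ * x.1

theorem content_eq (θ : ℝ) (x : ℕ × ℕ) : content θ x = (boxContent θ x : ℂ) := by
  simp [content, boxContent]

theorem EdgeAt.boxContent_lower {μ ν : YoungDiagram} {i : ℕ} (h : EdgeAt μ ν i) (θ : ℝ) :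
    boxContent θ (newBox μ ν) = rowContent θ μ i := by
  rw [h.newBox_eq]; rfl

theorem EdgeAt.boxContent_upper {μ ν : YoungDiagram} {i : ℕ} (h : EdgeAt μ ν i) (θ : ℝ) :
    boxContent θ (newBox μ ν) = rowContent θ ν i - 1 := by
  rw [h.boxContent_lower, h.rowContent_self, add_sub_cancel_right]

/-- Rows that cannot be extended have weight zero, so that sums over addable rows extend to all
rows. -/
theorem rowWeight_eq_zero_of_not_addable (θ : ℝ) {lam : YoungDiagram} {i M : ℕ} (hi : i < M)
    (h : ¬ Addable lam i) :
    rowWeight θ (rowContent θ lam) M i (rowContent θ lam i) = 0 := by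
  simp only [Addable, not_forall, not_lt] at h
  obtain ⟨k, hk, hle⟩ := h
  have h1 : lam.rowLen (i - 1) = lam.rowLen i := by
    have := lam.rowLen_anti k (i - 1) (by omega)
    have := lam.rowLen_anti (i - 1) i (by omega)
    omega
  have hmem : i - 1 ∈ (Finset.range M).erase i :=
    Finset.mem_erase.2 ⟨by omega, Finset.mem_range.2 (by omega)⟩
  have h2 : rowContent θ lam i - rowContent θ lam (i - 1) = -θ := by
    rw [rowContent, rowContent, h1, Nat.cast_sub (by omega)]; push_cast; ring
  rw [rowWeight, Finset.prod_eq_zero hmem (by rw [h2, rowFactor]; simp), zero_mul]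

theorem rowWeight_eq_zero_of_not_removable (θ : ℝ) {lam : YoungDiagram} {i M : ℕ} (hi : i < M)
    (hM : lam.rowLen M = 0) (h : ¬ Removable lam i) :
    rowWeight θ (rowContent θ lam) M i (rowContent θ lam i - 1) = 0 := by
  simp only [Removable, not_forall, not_lt] at h
  obtain ⟨k, hk, hle⟩ := h
  have h1 : lam.rowLen (i + 1) = lam.rowLen i := by
    have := lam.rowLen_anti i (i + 1) (by omega)
    have := lam.rowLen_anti (i + 1) k (by omega)
    omega
  rcases eq_or_lt_of_le (Nat.succ_le_of_lt hi) with rfl | hi'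
  · have h2 : rowContent θ lam i = - (θ * i) := by
      rw [rowContent, ← h1, hM]; simp
    rw [rowWeight, h2, show -(θ * i) - 1 - -(θ * (i.succ : ℕ)) + 1 - θ = 0 by push_cast; ring,
      zero_div, mul_zero]
  · have hmem : i + 1 ∈ (Finset.range M).erase i :=
      Finset.mem_erase.2 ⟨by omega, Finset.mem_range.2 hi'⟩
    have h2 : rowContent θ lam i - 1 - rowContent θ lam (i + 1) = θ - 1 := by
      rw [rowContent, rowContent, h1]; push_cast; ring
    rw [rowWeight, Finset.prod_eq_zero hmem (by rw [h2, rowFactor]; simp), zero_mul]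

/-- For irrational `θ` no two of the poles coincide. -/
theorem simplePoles_of_irrational {θ : ℝ} (hθ : Irrational θ) {lam : YoungDiagram} {M : ℕ} :
    SimplePoles (rowContent θ lam) (-(θ * M)) M := by
  -- an integer relation between `1` and `θ` is trivial
  have key : ∀ (a b : ℤ), (a : ℝ) = θ * b → b = 0 := by
    intro a b h
    by_contra hb
    refine hθ ⟨(a : ℚ) / b, ?_⟩
    have : (b : ℝ) ≠ 0 := by exact_mod_cast hb
    push_cast
    rw [h]; field_simp
  refine ⟨fun i _ j _ h => ?_, fun i _ j _ h => ?_, fun i hi h => ?_, fun i hi h => ?_⟩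
  · simp only [rowContent] at h
    have := key (lam.rowLen i - lam.rowLen j) (i - j) (by push_cast; linarith)
    omega
  · simp only [rowContent] at h
    have h0 := key (lam.rowLen i - lam.rowLen j + 1) (i - j) (by push_cast; linarith)
    obtain rfl : i = j := by omega
    linarith
  · simp only [rowContent] at h
    have := key (lam.rowLen i) (i - M) (by push_cast; linarith)
    omega
  · simp only [rowContent] at h
    have := key (lam.rowLen i - 1) (i - M) (by push_cast; linarith)
    omega

/-- Division by the common residue `θ (1 - θ)`; the row `M` is empty, which makes the residue at the
pole `-θ (M + 1)` vanish. -/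
theorem sum_rowWeight_of_irrational {θ : ℝ} (hθ : Irrational θ) {lam : YoungDiagram} {M : ℕ}
    (hM : lam.rowLen M = 0) {f : ℝ[X]} {v : ℝ}
    (h : dividedDiff (jackPoles (rowContent θ lam) (-(θ * (M + 1 : ℕ))) (Finset.range (M + 1)))
      (jackNum θ (rowContent θ lam) (-(θ * (M + 1 : ℕ))) (M + 1) * f) = θ * (1 - θ) * v) :
    ∑ i ∈ Finset.range (M + 1),
      (rowWeight θ (rowContent θ lam) (M + 1) i (rowContent θ lam i) * f.eval (rowContent θ lam i) -
      rowWeight θ (rowContent θ lam) (M + 1) i (rowContent θ lam i - 1) *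
        f.eval (rowContent θ lam i - 1)) = v := by
  have hs : θ * (1 - θ) ≠ 0 := mul_ne_zero hθ.ne_zero (sub_ne_zero.2 hθ.ne_one.symm)
  rw [(simplePoles_of_irrational hθ).dividedDiff_eq_sum] at h
  · exact mul_left_cancel₀ hs h
  · refine ⟨M, Nat.lt_succ_self M, ?_⟩
    rw [rowContent, hM, rowFactor]
    push_cast
    rw [show -(θ * ((M : ℝ) + 1)) - (0 - θ * M) + θ = 0 by ring, zero_mul, zero_div]

theorem sum_rowContent (θ : ℝ) {lam : YoungDiagram} {M : ℕ} (hM : lam.rowLen M = 0) :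
    ∑ i ∈ Finset.range M, rowContent θ lam i = lam.card - θ * (M * (M - 1) / 2) := by
  have h1 : ∀ n : ℕ, ∑ i ∈ Finset.range n, (i : ℝ) = n * (n - 1) / 2 := by
    intro n
    induction n with
    | zero => simp
    | succ n ih => rw [Finset.sum_range_succ, ih]; push_cast; ring
  simp only [rowContent]
  rw [Finset.sum_sub_distrib, ← Finset.mul_sum, h1, ← sum_rowLen hM]
  push_cast; rfl

/-- The values of the moments of order `0, 1, 2` of the edge weights at a diagram with `n` boxes,
upward minus downward. -/
noncomputable def momentValue (θ : ℝ) (n : ℕ) : Fin 3 → ℝ :=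
  ![1 / θ, 0, 2 * n]

theorem moments_of_irrational {θ : ℝ} (hθ : Irrational θ) {lam : YoungDiagram} {M : ℕ}
    (hM : lam.rowLen M = 0) (k : Fin 3) :
    ∑ i ∈ Finset.range (M + 1),
      (rowWeight θ (rowContent θ lam) (M + 1) i (rowContent θ lam i) *
        (rowContent θ lam i) ^ (k : ℕ) -
      rowWeight θ (rowContent θ lam) (M + 1) i (rowContent θ lam i - 1) *
        (rowContent θ lam i - 1) ^ (k : ℕ)) = momentValue θ lam.card k := by
  have hM' : lam.rowLen (M + 1) = 0 := rowLen_eq_zero_of_le hM (by omega)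
  obtain ⟨h0, h1, h2⟩ := (simplePoles_of_irrational (lam := lam) (M := M + 1) hθ).dividedDiff_jackNum θ
  have h0θ : θ ≠ 0 := hθ.ne_zero
  fin_cases k
  · have := sum_rowWeight_of_irrational hθ hM (f := 1) (v := 1 / θ)
      (by rw [mul_one, h0]; field_simp)
    simpa [momentValue] using this
  · have := sum_rowWeight_of_irrational hθ hM (f := Polynomial.X) (v := 0)
      (by rw [h1]; ring)
    simpa [momentValue] using this
  · have := sum_rowWeight_of_irrational hθ hM (f := Polynomial.X ^ 2) (v := 2 * lam.card)
      (by
        rw [h2, Finset.sum_sub_distrib, ← Finset.mul_sum, sum_rowContent θ hM']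
        simp only [Finset.sum_const, Finset.card_range, nsmul_eq_mul]
        push_cast; ring)
    simpa [momentValue] using this

theorem continuousAt_rowWeight {lam : YoungDiagram} {M i : ℕ} {x : ℝ → ℝ} {θ : ℝ}
    (hx : ContinuousAt x θ)
    (hne : ∀ k < M, k ≠ i → (x θ - rowContent θ lam k) * (x θ - rowContent θ lam k + 1) ≠ 0)
    (hne' : x θ - -(θ * M) ≠ 0) :
    ContinuousAt (fun θ => rowWeight θ (rowContent θ lam) M i (x θ)) θ := by
  unfold rowWeight
  refine ContinuousAt.mul (tendsto_finsetProd _ fun k hk => ?_) ?_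
  · unfold rowFactor
    have hk' := Finset.mem_erase.1 hk
    refine ContinuousAt.div ?_ ?_ (hne k (Finset.mem_range.1 hk'.2) hk'.1) <;>
    · simp only [rowContent]; fun_prop
  · exact ContinuousAt.div (by fun_prop) (by fun_prop) hne'

theorem Addable.continuousAt {lam : YoungDiagram} {i : ℕ} (h : Addable lam i) {θ : ℝ} (hθ : 0 < θ)
    {M : ℕ} (hi : i < M) :
    ContinuousAt (fun θ => rowWeight θ (rowContent θ lam) M i (rowContent θ lam i)) θ := by
  refine continuousAt_rowWeight (by simp only [rowContent]; fun_prop) (fun k _ hki => ?_) ?_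
  · simp only [rowContent]
    rcases lt_or_gt_of_ne hki with hk | hk
    · have h1 : (lam.rowLen i : ℝ) + 1 ≤ lam.rowLen k := by exact_mod_cast h k hk
      have h2 : θ * k < θ * i := mul_lt_mul_of_pos_left (by exact_mod_cast hk) hθ
      exact mul_ne_zero (by linarith) (by linarith)
    · have h1 : (lam.rowLen k : ℝ) ≤ lam.rowLen i := by exact_mod_cast lam.rowLen_anti i k hk.le
      have h2 : θ * i < θ * k := mul_lt_mul_of_pos_left (by exact_mod_cast hk) hθ
      exact mul_ne_zero (by linarith) (by linarith)
  · simp only [rowContent]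
    have h2 : θ * i < θ * M := mul_lt_mul_of_pos_left (by exact_mod_cast hi) hθ
    have h3 : (0 : ℝ) ≤ lam.rowLen i := Nat.cast_nonneg _
    linarith

theorem Removable.continuousAt {lam : YoungDiagram} {i : ℕ} (h : Removable lam i) {θ : ℝ}
    (hθ : 0 < θ) {M : ℕ} (hi : i < M) :
    ContinuousAt (fun θ => rowWeight θ (rowContent θ lam) M i (rowContent θ lam i - 1)) θ := by
  refine continuousAt_rowWeight (by simp only [rowContent]; fun_prop) (fun k _ hki => ?_) ?_
  · simp only [rowContent]
    rcases lt_or_gt_of_ne hki with hk | hk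
    · have h1 : (lam.rowLen i : ℝ) ≤ lam.rowLen k := by exact_mod_cast lam.rowLen_anti k i hk.le
      have h2 : θ * k < θ * i := mul_lt_mul_of_pos_left (by exact_mod_cast hk) hθ
      exact mul_ne_zero (by linarith) (by linarith)
    · have h1 : (lam.rowLen k : ℝ) + 1 ≤ lam.rowLen i := by exact_mod_cast h k hk
      have h2 : θ * i < θ * k := mul_lt_mul_of_pos_left (by exact_mod_cast hk) hθ
      exact mul_ne_zero (by linarith) (by linarith)
  · simp only [rowContent]
    have h2 : θ * i < θ * M := mul_lt_mul_of_pos_left (by exact_mod_cast hi) hθ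
    have h3 : (lam.rowLen (i + 1) : ℝ) + 1 ≤ lam.rowLen i := by exact_mod_cast h (i + 1) (by omega)
    have h4 : (0 : ℝ) ≤ lam.rowLen (i + 1) := Nat.cast_nonneg _
    linarith

/-- The first three moments of the edge weights, upward minus downward. They depend continuously on
`θ > 0`, so that it is enough to know them for irrational `θ`. -/
theorem sum_edgeWeight_mul_pow {θ : ℝ} (hθ : 0 < θ) (lam : YoungDiagram) (k : Fin 3) :
    ∑ ν ∈ upNbrs lam, edgeWeight θ lam ν * boxContent θ (newBox lam ν) ^ (k : ℕ) -
      ∑ μ ∈ downNbrs lam, edgeWeight θ μ lam * boxContent θ (newBox μ lam) ^ (k : ℕ) =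
      momentValue θ lam.card k := by
  classical
  rw [sum_upNbrs, sum_downNbrs, ← Finset.sum_sub_distrib]
  set M := lam.card
  have hM : lam.rowLen M = 0 := rowLen_card lam
  have hM' : lam.rowLen (M + 1) = 0 := rowLen_eq_zero_of_le hM (by omega)
  -- restricting the sums to addable and removable rows keeps the denominators away from `0`
  let g : ℝ → ℝ := fun θ => ∑ i ∈ Finset.range (M + 1),
    ((if Addable lam i then rowWeight θ (rowContent θ lam) (M + 1) i (rowContent θ lam i) *
        (rowContent θ lam i) ^ (k : ℕ) else 0) -
      (if Removable lam i then rowWeight θ (rowContent θ lam) (M + 1) i (rowContent θ lam i - 1) *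
        (rowContent θ lam i - 1) ^ (k : ℕ) else 0))
  have hL : ∑ i ∈ Finset.range (M + 1),
      ((if Addable lam i then edgeWeight θ lam (addBox lam i) *
          boxContent θ (newBox lam (addBox lam i)) ^ (k : ℕ) else 0) -
        (if Removable lam i then edgeWeight θ (removeBox lam i) lam *
          boxContent θ (newBox (removeBox lam i) lam) ^ (k : ℕ) else 0)) = g θ := by
    refine Finset.sum_congr rfl fun i hi => ?_
    have hi' := Finset.mem_range.1 hi
    congr 1
    · split_ifs with h
      · rw [h.edgeAt.edgeWeight_lower hθ hi' hM', h.edgeAt.boxContent_lower]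
      · rfl
    · split_ifs with h
      · rw [h.edgeAt.edgeWeight_upper hθ hi' hM', h.edgeAt.boxContent_upper]
      · rfl
  rw [hL]
  have hg : ContinuousAt g θ := by
    refine tendsto_finsetSum _ fun i hi => ?_
    have hi' := Finset.mem_range.1 hi
    refine Tendsto.sub ?_ ?_
    · split_ifs with h
      · exact (h.continuousAt hθ hi').mul (by simp only [rowContent]; fun_prop)
      · exact tendsto_const_nhds
    · split_ifs with h
      · exact (h.continuousAt hθ hi').mul (by simp only [rowContent]; fun_prop)
      · exact tendsto_const_nhds
  have hv : ContinuousAt (fun θ => momentValue θ M k) θ := by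
    fin_cases k
    · simpa [momentValue] using continuousAt_inv₀ hθ.ne'
    · simpa [momentValue] using continuousAt_const
    · simpa [momentValue] using continuousAt_const
  have hdense : (𝓝[{x | Irrational x}] θ).NeBot := 
    mem_closure_iff_nhdsWithin_neBot.1 (dense_irrational θ)
  refine tendsto_nhds_unique (hg.tendsto.mono_left (nhdsWithin_le_nhds (s := {x | Irrational x})))
    ((hv.tendsto.mono_left nhdsWithin_le_nhds).congr' ?_)
  filter_upwards [self_mem_nhdsWithin] with x hx
  rw [← moments_of_irrational hx hM k]
  refine Finset.sum_congr rfl fun i hi => ?_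
  have hi' := Finset.mem_range.1 hi
  congr 1
  · split_ifs with h
    · rfl
    · rw [rowWeight_eq_zero_of_not_addable x hi' h, zero_mul]
  · split_ifs with h
    · rfl
    · rw [rowWeight_eq_zero_of_not_removable x hi' hM' h, zero_mul]

/-- The relation between the edge weights at a diagram that makes `[D, U]` act as the scalar
`2 |λ| + z z' / θ`. -/
theorem sum_edgeWeight_mul_content {θ : ℝ} (hθ : 0 < θ) (lam : YoungDiagram) (z z' : ℂ) :
    ∑ ν ∈ upNbrs lam, (edgeWeight θ lam ν : ℂ) *
        ((z + content θ (newBox lam ν)) * (z' + content θ (newBox lam ν))) -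
      ∑ μ ∈ downNbrs lam, (edgeWeight θ μ lam : ℂ) *
        ((z + content θ (newBox μ lam)) * (z' + content θ (newBox μ lam))) =
      2 * lam.card + z * z' / θ := by
  have h0 := congrArg (Complex.ofReal) (sum_edgeWeight_mul_pow hθ lam 0)
  have h1 := congrArg (Complex.ofReal) (sum_edgeWeight_mul_pow hθ lam 1)
  have h2 := congrArg (Complex.ofReal) (sum_edgeWeight_mul_pow hθ lam 2)
  simp only [momentValue, Fin.val_zero, Fin.val_one, Fin.val_two, pow_zero, pow_one, mul_one,
    Matrix.cons_val_zero, Matrix.cons_val_one, Matrix.cons_val] at h0 h1 h2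
  push_cast at h0 h1 h2
  have e : ∀ w c : ℂ, w * ((z + c) * (z' + c)) = z * z' * w + (z + z') * (w * c) + w * c ^ 2 :=
    fun w c => by ring
  simp only [content_eq, e, Finset.sum_add_distrib, ← Finset.mul_sum]
  linear_combination (z * z') * h0 + (z + z') * h1 + h2

/-! ### The hook product along an edge -/

theorem prod_Ico_telescope (h : ℕ → ℝ) (hne : ∀ a, h a ≠ 0) {j₀ a b : ℕ} (hab : a ≤ b)
    (hb : b ≤ j₀) :
    ∏ j ∈ Finset.Ico a b, h (j₀ - j) / h (j₀ - 1 - j) = h (j₀ - a) / h (j₀ - b) := by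
  induction b, hab using Nat.le_induction with
  | base => simp [hne]
  | succ b hab ih =>
    rw [Finset.prod_Ico_succ_top hab, ih (by omega), show j₀ - 1 - b = j₀ - (b + 1) by omega]
    have := hne (j₀ - b)
    field_simp

/-- Telescoping along the boundary path of a diagram with row lengths `m k ≤ j₀` and column lengths
`c j`, from the corner of the `j₀`-wide strip to its bottom: a vertical step in row `k` contributes
the quotient of the values of `h` at `(j₀ - m k, k + 1)` and `(j₀ - m k, k)`, a horizontal step in
column `j` the one at `(j₀ - j, c j)` and `(j₀ - 1 - j, c j)`. -/
theorem prod_boundary_telescope (h : ℕ → ℕ → ℝ) (hne : ∀ a l, h a l ≠ 0) (m c : ℕ → ℕ) (j₀ : ℕ)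
    (hm : Antitone m) (hmj : ∀ k, m k ≤ j₀) (hc : ∀ k, ∀ j < j₀, k < c j ↔ j < m k) (K : ℕ) :
    (∏ k ∈ Finset.range K, h (j₀ - m k) (k + 1) / h (j₀ - m k) k) *
      ∏ j ∈ Finset.Ico (m K) j₀, h (j₀ - j) (c j) / h (j₀ - 1 - j) (c j) =
      h (j₀ - m K) K / h 0 0 := by
  induction K with
  | zero =>
    have h1 : ∏ j ∈ Finset.Ico (m 0) j₀, h (j₀ - j) (c j) / h (j₀ - 1 - j) (c j) =
        ∏ j ∈ Finset.Ico (m 0) j₀, h (j₀ - j) 0 / h (j₀ - 1 - j) 0 := by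
      refine Finset.prod_congr rfl fun j hj => ?_
      obtain ⟨hj1, hj2⟩ := Finset.mem_Ico.1 hj
      have := hc 0 j hj2
      rw [show c j = 0 by omega]
    rw [h1, prod_Ico_telescope (fun a => h a 0) (fun a => hne a 0) (hmj 0) le_rfl]
    simp
  | succ K ih =>
    have hmK := hm (Nat.le_succ K)
    rw [← Finset.prod_Ico_consecutive _ hmK (hmj K), Finset.prod_range_succ]
    have h1 : ∏ j ∈ Finset.Ico (m (K + 1)) (m K), h (j₀ - j) (c j) / h (j₀ - 1 - j) (c j) =
        ∏ j ∈ Finset.Ico (m (K + 1)) (m K), h (j₀ - j) (K + 1) / h (j₀ - 1 - j) (K + 1) := by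
      refine Finset.prod_congr rfl fun j hj => ?_
      obtain ⟨hj1, hj2⟩ := Finset.mem_Ico.1 hj
      have hj3 := hj2.trans_le (hmj K)
      have := hc K j hj3
      have := hc (K + 1) j hj3
      rw [show c j = K + 1 by omega]
    rw [h1, prod_Ico_telescope (fun a => h a (K + 1)) (fun a => hne a _) hmK (hmj K)]
    have e : ∀ A B x y w : ℝ, A * (x / y) * (w / x * B) = A * B * (x / x) * (w / y) := by
      intros; ring
    rw [e, ih, div_self (hne _ _)]
    have := hne (j₀ - m K) K
    field_simp

/-- `prod_boundary_telescope` for the rows below the end of row `i` and the columns to its left. -/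
theorem boundary_telescope (μ : YoungDiagram) (i : ℕ) (f : ℕ → ℕ → ℝ) (hne : ∀ a l, f a l ≠ 0) {K : ℕ}
    (hK : μ.rowLen (i + 1 + K) = 0) :
    (∏ k ∈ Finset.range K, f (μ.rowLen i - μ.rowLen (i + 1 + k)) (k + 1) /
        f (μ.rowLen i - μ.rowLen (i + 1 + k)) k) *
      ∏ j ∈ Finset.range (μ.rowLen i), f (μ.rowLen i - j) (μ.colLen j - (i + 1)) /
        f (μ.rowLen i - 1 - j) (μ.colLen j - (i + 1)) = f (μ.rowLen i) K / f 0 0 := by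
  have := prod_boundary_telescope f hne (fun k => μ.rowLen (i + 1 + k))
    (fun j => μ.colLen j - (i + 1)) (μ.rowLen i) (fun a b hab => μ.rowLen_anti _ _ (by omega))
    (fun k => μ.rowLen_anti _ _ (by omega)) (fun k j _ => by
      rw [← YoungDiagram.mem_iff_lt_rowLen, YoungDiagram.mem_iff_lt_colLen]; omega) K
  simpa only [hK, Nat.sub_zero, ← Finset.range_eq_Ico] using this

theorem succ_le_colLen {μ : YoungDiagram} {i j : ℕ} (hj : j < μ.rowLen i) : i + 1 ≤ μ.colLen j :=
  YoungDiagram.mem_iff_lt_colLen.1 (YoungDiagram.mem_iff_lt_rowLen.2 hj)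

/-- The factor of a box with arm `a` and leg `l` in `hookProduct`. -/
noncomputable def hookFactor (θ a l : ℝ) : ℝ :=
  (a + θ * l + 1) * (a + θ * l + θ)

theorem hookFactor_pos {θ a l : ℝ} (hθ : 0 < θ) (ha : 0 ≤ a) (hl : 0 ≤ l) :
    0 < hookFactor θ a l := by
  unfold hookFactor; positivity

theorem hookProduct_eq (θ : ℝ) (lam : YoungDiagram) :
    hookProduct θ lam = ∏ x ∈ lam.cells,
      hookFactor θ ((lam.rowLen x.1 : ℝ) - x.2 - 1) ((lam.colLen x.2 : ℝ) - x.1 - 1) :=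
  rfl

theorem hookFactor_mem_pos {θ : ℝ} (hθ : 0 < θ) {lam : YoungDiagram} {x : ℕ × ℕ} (hx : x ∈ lam) :
    0 < hookFactor θ ((lam.rowLen x.1 : ℝ) - x.2 - 1) ((lam.colLen x.2 : ℝ) - x.1 - 1) := by
  have h1 : (x.2 : ℝ) + 1 ≤ lam.rowLen x.1 := by
    exact_mod_cast YoungDiagram.mem_iff_lt_rowLen.1 (show (x.1, x.2) ∈ lam from hx)
  have h2 : (x.1 : ℝ) + 1 ≤ lam.colLen x.2 := by
    exact_mod_cast YoungDiagram.mem_iff_lt_colLen.1 (show (x.1, x.2) ∈ lam from hx)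
  exact hookFactor_pos hθ (by linarith) (by linarith)

theorem hookProduct_pos {θ : ℝ} (hθ : 0 < θ) (lam : YoungDiagram) : 0 < hookProduct θ lam := by
  rw [hookProduct_eq]
  exact Finset.prod_pos fun x hx => hookFactor_mem_pos hθ ((YoungDiagram.mem_cells _).1 hx)

/-- The weights that describe the removal of a box from row `i` of a diagram with row contents `e`;
they sum to the number of boxes. -/
noncomputable def removalWeight (θ : ℝ) (e : ℕ → ℝ) (M i : ℕ) : ℝ :=
  (e i + θ * (M - 1)) * ∏ k ∈ (Finset.range M).erase i, (e i - e k - θ) / (e i - e k)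

namespace EdgeAt

variable {μ ν : YoungDiagram} {i : ℕ}

/-- The change of the hook product along an edge comes from the boxes above and to the left of the
new box. -/
theorem hookProduct_upper (h : EdgeAt μ ν i) {θ : ℝ} (hθ : 0 < θ) :
    hookProduct θ ν = θ * hookProduct θ μ *
      ((∏ k ∈ Finset.range i,
          hookFactor θ ((μ.rowLen k : ℝ) - μ.rowLen i - 1) ((i : ℝ) - k) /
            hookFactor θ ((μ.rowLen k : ℝ) - μ.rowLen i - 1) ((i : ℝ) - k - 1)) *
        ∏ j ∈ Finset.range (μ.rowLen i),
          hookFactor θ ((μ.rowLen i : ℝ) - j) ((μ.colLen j : ℝ) - i - 1) /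
            hookFactor θ ((μ.rowLen i : ℝ) - j - 1) ((μ.colLen j : ℝ) - i - 1)) := by
  classical
  set g : ℕ × ℕ → ℝ := fun x =>
    hookFactor θ ((ν.rowLen x.1 : ℝ) - x.2 - 1) ((ν.colLen x.2 : ℝ) - x.1 - 1) /
      hookFactor θ ((μ.rowLen x.1 : ℝ) - x.2 - 1) ((μ.colLen x.2 : ℝ) - x.1 - 1) with hg
  have h1 : hookProduct θ ν = θ * (hookProduct θ μ * ∏ x ∈ μ.cells, g x) := by
    rw [hookProduct_eq, hookProduct_eq, ← Finset.prod_mul_distrib, h,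
      Finset.prod_insert (notMem_rowEnd μ i)]
    congr 1
    · simp only [hookFactor, h.rowLen_self, h.colLen_upper]
      push_cast; ring
    · refine Finset.prod_congr rfl fun x hx => ?_
      rw [hg, mul_div_cancel₀ _ (hookFactor_mem_pos hθ ((YoungDiagram.mem_cells _).1 hx)).ne']
  let A : Finset (ℕ × ℕ) := (Finset.range i).image fun k => (k, μ.rowLen i)
  let B : Finset (ℕ × ℕ) := (Finset.range (μ.rowLen i)).image fun j => (i, j)
  have hA : A ⊆ μ.cells := by
    intro x hx
    obtain ⟨k, hk, rfl⟩ := Finset.mem_image.1 hx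
    rw [YoungDiagram.mem_cells, YoungDiagram.mem_iff_lt_rowLen]
    exact h.addable k (Finset.mem_range.1 hk)
  have hB : B ⊆ μ.cells := by
    intro x hx
    obtain ⟨j, hj, rfl⟩ := Finset.mem_image.1 hx
    rw [YoungDiagram.mem_cells, YoungDiagram.mem_iff_lt_rowLen]
    exact Finset.mem_range.1 hj
  have hdisj : Disjoint A B := by
    rw [Finset.disjoint_left]
    intro x hx hx'
    obtain ⟨k, hk, rfl⟩ := Finset.mem_image.1 hx
    obtain ⟨j, hj, hjk⟩ := Finset.mem_image.1 hx'
    have := congrArg Prod.fst hjk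
    have := Finset.mem_range.1 hk
    simp at *; omega
  have h2 : ∏ x ∈ μ.cells, g x = (∏ x ∈ A, g x) * ∏ x ∈ B, g x := by
    rw [← Finset.prod_union hdisj]
    refine (Finset.prod_subset (Finset.union_subset hA hB) ?_).symm
    rintro ⟨k, j⟩ hx hx'
    rw [Finset.mem_union, not_or] at hx'
    have hk : k ≠ i := by
      rintro rfl
      refine hx'.2 (Finset.mem_image.2 ⟨j, Finset.mem_range.2 ?_, rfl⟩)
      rwa [YoungDiagram.mem_cells, YoungDiagram.mem_iff_lt_rowLen] at hx
    have hj : j ≠ μ.rowLen i := by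
      rintro rfl
      refine hx'.1 (Finset.mem_image.2 ⟨k, Finset.mem_range.2 ?_, rfl⟩)
      rwa [YoungDiagram.mem_cells, YoungDiagram.mem_iff_lt_colLen, h.colLen_lower] at hx
    simp only [hg, h.rowLen_of_ne hk, h.colLen_of_ne hj]
    exact div_self (hookFactor_mem_pos hθ ((YoungDiagram.mem_cells _).1 hx)).ne'
  rw [h1, h2, mul_assoc, Finset.prod_image fun a _ b _ hab => congrArg Prod.fst hab,
    Finset.prod_image fun a _ b _ hab => congrArg Prod.snd hab]
  congr 3
  · refine Finset.prod_congr rfl fun k hk => ?_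
    have := Finset.mem_range.1 hk
    simp only [hg, h.rowLen_of_ne (show k ≠ i by omega), h.colLen_upper, h.colLen_lower]
    congr 2; push_cast; ring
  · refine Finset.prod_congr rfl fun j hj => ?_
    have := Finset.mem_range.1 hj
    simp only [hg, h.rowLen_self, h.colLen_of_ne (show j ≠ μ.rowLen i by omega)]
    congr 2; push_cast; ring

/-- The dual multiplicity as a product over the boxes to the left of the new box. -/
theorem jackMultDual_eq_prod_left (h : EdgeAt μ ν i) {θ : ℝ} (hθ : 0 < θ) :
    jackMultDual θ μ ν = θ⁻¹ * ∏ j ∈ Finset.range (μ.rowLen i),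
      ((((μ.rowLen i - 1 - j : ℕ) : ℝ) + 2 + θ * (μ.colLen j - (i + 1) : ℕ)) /
          (((μ.rowLen i - 1 - j : ℕ) : ℝ) + 1 + θ * (μ.colLen j - (i + 1) : ℕ))) /
        ((((μ.rowLen i - 1 - j : ℕ) : ℝ) + 1 + θ * ((μ.colLen j - (i + 1) : ℕ) + 1)) /
          (((μ.rowLen i - 1 - j : ℕ) : ℝ) + θ * ((μ.colLen j - (i + 1) : ℕ) + 1))) := by
  set K := μ.card
  have hK : μ.rowLen (i + 1 + K) = 0 := rowLen_eq_zero_of_le (rowLen_card μ) (by omega)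
  -- the potential with `F θ a l = r a l / r a (l + 1)`
  let r : ℕ → ℕ → ℝ := fun a l => ((a : ℝ) + 1 + θ * l) / (a + θ * (l + 1))
  have hr : ∀ a l, 0 < r a l := fun a l => by simp only [r]; positivity
  have ht := boundary_telescope μ i r (fun a l => (hr a l).ne') hK
  rw [h.jackMultDual_eq hθ K hK]
  have h1 : ∏ k ∈ Finset.range K, r (μ.rowLen i - μ.rowLen (i + 1 + k)) (k + 1) /
      r (μ.rowLen i - μ.rowLen (i + 1 + k)) k =
      (∏ k ∈ Finset.range K, F θ ((μ.rowLen i : ℝ) - μ.rowLen (i + 1 + k)) k)⁻¹ := by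
    rw [← Finset.prod_inv_distrib]
    refine Finset.prod_congr rfl fun k _ => ?_
    rw [← Nat.cast_sub (μ.rowLen_anti _ _ (by omega))]
    simp only [r, F]
    push_cast
    rw [inv_div, div_div_div_eq, add_assoc (k : ℝ) 1 1, one_add_one_eq_two]
    congr 1
    ring
  have hF : ∏ k ∈ Finset.range K, F θ ((μ.rowLen i : ℝ) - μ.rowLen (i + 1 + k)) k ≠ 0 :=
    fun h0 => (h.jackMultDual_pos hθ).ne' (by rw [h.jackMultDual_eq hθ K hK, h0, zero_mul])
  have h2 : ∏ j ∈ Finset.range (μ.rowLen i), r (μ.rowLen i - j) (μ.colLen j - (i + 1)) /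
      r (μ.rowLen i - 1 - j) (μ.colLen j - (i + 1)) = ∏ j ∈ Finset.range (μ.rowLen i),
      ((((μ.rowLen i - 1 - j : ℕ) : ℝ) + 2 + θ * (μ.colLen j - (i + 1) : ℕ)) /
          (((μ.rowLen i - 1 - j : ℕ) : ℝ) + 1 + θ * (μ.colLen j - (i + 1) : ℕ))) /
        ((((μ.rowLen i - 1 - j : ℕ) : ℝ) + 1 + θ * ((μ.colLen j - (i + 1) : ℕ) + 1)) /
          (((μ.rowLen i - 1 - j : ℕ) : ℝ) + θ * ((μ.colLen j - (i + 1) : ℕ) + 1))) := by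
    refine Finset.prod_congr rfl fun j hj => ?_
    have := Finset.mem_range.1 hj
    rw [show μ.rowLen i - j = (μ.rowLen i - 1 - j) + 1 by omega]
    simp only [r]
    push_cast
    rw [div_div_div_eq, div_div_div_eq, add_assoc _ (1 : ℝ) 1, one_add_one_eq_two]
    congr 1
    ring
  rw [← h2]
  rw [h1] at ht
  have h3 : r 0 0 = θ⁻¹ := by simp [r]
  rw [h3, div_inv_eq_mul] at ht
  have h4 : ∏ j ∈ Finset.range (μ.rowLen i), r (μ.rowLen i - j) (μ.colLen j - (i + 1)) /
      r (μ.rowLen i - 1 - j) (μ.colLen j - (i + 1)) =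
      (∏ k ∈ Finset.range K, F θ ((μ.rowLen i : ℝ) - μ.rowLen (i + 1 + k)) k) *
        (r (μ.rowLen i) K * θ) := by
    rw [← ht, mul_inv_cancel_left₀ hF]
  rw [h4]
  have := hθ.ne'
  change _ * r (μ.rowLen i) K = _
  field_simp

/-- `removalWeight` in terms of the boxes above and to the left of the removed one. -/
theorem removalWeight_eq (h : EdgeAt μ ν i) {θ : ℝ} (hθ : 0 < θ) {M : ℕ} (hi : i < M)
    (hM : ν.rowLen M = 0) :
    removalWeight θ (rowContent θ ν) M i =
      (∏ k ∈ Finset.range i, (((μ.rowLen k : ℝ) - μ.rowLen i - 1) + θ * ((i : ℝ) - k + 1)) /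
        (((μ.rowLen k : ℝ) - μ.rowLen i - 1) + θ * ((i : ℝ) - k))) *
      ∏ j ∈ Finset.range (μ.rowLen i),
        (((μ.rowLen i - 1 - j : ℕ) : ℝ) + 2 + θ * (μ.colLen j - (i + 1) : ℕ)) /
          (((μ.rowLen i - 1 - j : ℕ) : ℝ) + 1 + θ * (μ.colLen j - (i + 1) : ℕ)) := by
  obtain ⟨K, rfl⟩ : ∃ K, M = i + 1 + K := ⟨M - (i + 1), by omega⟩
  have hK : μ.rowLen (i + 1 + K) = 0 := by rw [← h.rowLen_of_ne (by omega), hM]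
  -- the potential whose horizontal steps are the factors of the boxes to the left
  let r : ℕ → ℕ → ℝ := fun a l => (a : ℝ) + 1 + θ * l
  have hr : ∀ a l, 0 < r a l := fun a l => by simp only [r]; positivity
  have ht := boundary_telescope μ i r (fun a l => (hr a l).ne') hK
  have h0 : r 0 0 = 1 := by simp [r]
  have hL : ∏ j ∈ Finset.range (μ.rowLen i), r (μ.rowLen i - j) (μ.colLen j - (i + 1)) /
      r (μ.rowLen i - 1 - j) (μ.colLen j - (i + 1)) = ∏ j ∈ Finset.range (μ.rowLen i),
      (((μ.rowLen i - 1 - j : ℕ) : ℝ) + 2 + θ * (μ.colLen j - (i + 1) : ℕ)) /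
          (((μ.rowLen i - 1 - j : ℕ) : ℝ) + 1 + θ * (μ.colLen j - (i + 1) : ℕ)) := by
    refine Finset.prod_congr rfl fun j hj => ?_
    have := Finset.mem_range.1 hj
    rw [show μ.rowLen i - j = (μ.rowLen i - 1 - j) + 1 by omega]
    simp only [r]
    push_cast
    rw [add_assoc _ (1 : ℝ) 1, one_add_one_eq_two]
  rw [h0, div_one, hL] at ht
  have h1 : ∏ k ∈ (Finset.range (i + 1 + K)).erase i,
      (rowContent θ ν i - rowContent θ ν k - θ) / (rowContent θ ν i - rowContent θ ν k) =
      ∏ k ∈ Finset.range (i + 1 + K), if k = i then 1 else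
        (rowContent θ ν i - rowContent θ ν k - θ) / (rowContent θ ν i - rowContent θ ν k) := by
    rw [← Finset.mul_prod_erase (Finset.range (i + 1 + K)) _ (a := i) (Finset.mem_range.2 hi),
      if_pos rfl, one_mul]
    exact Finset.prod_congr rfl fun k hk => by rw [if_neg (Finset.ne_of_mem_erase hk)]
  have h2 : ∏ k ∈ Finset.range K, (if i + 1 + k = i then 1 else
      (rowContent θ ν i - rowContent θ ν (i + 1 + k) - θ) /
        (rowContent θ ν i - rowContent θ ν (i + 1 + k))) =
      (∏ k ∈ Finset.range K, r (μ.rowLen i - μ.rowLen (i + 1 + k)) (k + 1) /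
        r (μ.rowLen i - μ.rowLen (i + 1 + k)) k)⁻¹ := by
    rw [← Finset.prod_inv_distrib]
    refine Finset.prod_congr rfl fun k _ => ?_
    rw [if_neg (by omega), inv_div]
    simp only [r]
    rw [Nat.cast_sub (μ.rowLen_anti _ _ (by omega)), rowContent, rowContent, h.rowLen_self,
      h.rowLen_of_ne (by omega)]
    push_cast
    congr 1 <;> ring
  have h3 : ∏ k ∈ Finset.range i, (if k = i then 1 else
      (rowContent θ ν i - rowContent θ ν k - θ) / (rowContent θ ν i - rowContent θ ν k)) =
      ∏ k ∈ Finset.range i, (((μ.rowLen k : ℝ) - μ.rowLen i - 1) + θ * ((i : ℝ) - k + 1)) /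
        (((μ.rowLen k : ℝ) - μ.rowLen i - 1) + θ * ((i : ℝ) - k)) := by
    refine Finset.prod_congr rfl fun k hk => ?_
    have := Finset.mem_range.1 hk
    rw [if_neg (by omega), ← neg_div_neg_eq, rowContent, rowContent, h.rowLen_self,
      h.rowLen_of_ne (by omega)]
    push_cast
    congr 1 <;> ring
  have hP : ∏ k ∈ Finset.range K, r (μ.rowLen i - μ.rowLen (i + 1 + k)) (k + 1) /
        r (μ.rowLen i - μ.rowLen (i + 1 + k)) k ≠ 0 :=
    Finset.prod_ne_zero_iff.2 fun k _ => (div_pos (hr _ _) (hr _ _)).ne'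
  rw [removalWeight, h1, Finset.prod_range_add, Finset.prod_range_succ, if_pos rfl, mul_one, h2, h3]
  have h4 : rowContent θ ν i + θ * (((i + 1 + K : ℕ) : ℝ) - 1) = r (μ.rowLen i) K := by
    simp only [r, rowContent, h.rowLen_self]; push_cast; ring
  rw [h4, ← ht]
  field_simp

theorem removalWeight_pos (h : EdgeAt μ ν i) {θ : ℝ} (hθ : 0 < θ) {M : ℕ} (hi : i < M)
    (hM : ν.rowLen M = 0) : 0 < removalWeight θ (rowContent θ ν) M i := by
  rw [h.removalWeight_eq hθ hi hM]
  refine mul_pos (Finset.prod_pos fun k hk => ?_) (Finset.prod_pos fun j _ => by positivity)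
  have hk' := Finset.mem_range.1 hk
  have h1 : (μ.rowLen i : ℝ) + 1 ≤ μ.rowLen k := by exact_mod_cast h.addable k hk'
  have h2 : (0 : ℝ) < i - k := sub_pos.2 (by exact_mod_cast hk')
  have h3 : (0 : ℝ) ≤ (μ.rowLen k : ℝ) - μ.rowLen i - 1 := by linarith
  positivity

/-- The edge weight is the ratio of the hook products up to the square of `removalWeight`. -/
theorem edgeWeight_mul_hookProduct (h : EdgeAt μ ν i) {θ : ℝ} (hθ : 0 < θ) {M : ℕ} (hi : i < M)
    (hM : ν.rowLen M = 0) :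
    edgeWeight θ μ ν * hookProduct θ ν =
      removalWeight θ (rowContent θ ν) M i ^ 2 * hookProduct θ μ := by
  rw [h.removalWeight_eq hθ hi hM, edgeWeight, h.jackMultDual_eq_prod_left hθ, h.jackMult_eq,
    h.hookProduct_upper hθ]
  have hA : (∏ k ∈ Finset.range i, F θ ((μ.rowLen k : ℝ) - μ.rowLen i - 1) ((i : ℝ) - k - 1)) *
      (∏ k ∈ Finset.range i,
          hookFactor θ ((μ.rowLen k : ℝ) - μ.rowLen i - 1) ((i : ℝ) - k) /
            hookFactor θ ((μ.rowLen k : ℝ) - μ.rowLen i - 1) ((i : ℝ) - k - 1)) =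
      (∏ k ∈ Finset.range i, (((μ.rowLen k : ℝ) - μ.rowLen i - 1) + θ * ((i : ℝ) - k + 1)) /
        (((μ.rowLen k : ℝ) - μ.rowLen i - 1) + θ * ((i : ℝ) - k))) ^ 2 := by
    rw [← Finset.prod_mul_distrib, ← Finset.prod_pow]
    refine Finset.prod_congr rfl fun k hk => ?_
    have hk' := Finset.mem_range.1 hk
    have h1 : (μ.rowLen i : ℝ) + 1 ≤ μ.rowLen k := by exact_mod_cast h.addable k hk'
    have h2 : (k : ℝ) + 1 ≤ i := by exact_mod_cast hk'
    obtain ⟨a, ha⟩ : ∃ a : ℝ, a = (μ.rowLen k : ℝ) - μ.rowLen i - 1 := ⟨_, rfl⟩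
    obtain ⟨l, hl⟩ : ∃ l : ℝ, l = (i : ℝ) - k - 1 := ⟨_, rfl⟩
    have ha0 : 0 ≤ a := by linarith
    have hl0 : 0 ≤ l := by linarith
    rw [← ha, show (i : ℝ) - k = l + 1 by linarith, show l + 1 - 1 = l by ring, F, hookFactor,
      hookFactor]
    have n1 : a + θ * (l + 1) ≠ 0 := by positivity
    have n2 : a + 1 + θ * (l + 1) ≠ 0 := by positivity
    have n3 : a + 1 + θ * l ≠ 0 := by positivity
    rw [show a + θ * (l + 1) + 1 = a + 1 + θ * (l + 1) by ring,
      show a + θ * (l + 1) + θ = a + θ * (l + 2) by ring,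
      show a + θ * l + 1 = a + 1 + θ * l by ring, show a + θ * l + θ = a + θ * (l + 1) by ring,
      show a + θ * (l + 1 + 1) = a + θ * (l + 2) by ring]
    field_simp
  have hB : (∏ j ∈ Finset.range (μ.rowLen i),
      ((((μ.rowLen i - 1 - j : ℕ) : ℝ) + 2 + θ * (μ.colLen j - (i + 1) : ℕ)) /
          (((μ.rowLen i - 1 - j : ℕ) : ℝ) + 1 + θ * (μ.colLen j - (i + 1) : ℕ))) /
        ((((μ.rowLen i - 1 - j : ℕ) : ℝ) + 1 + θ * ((μ.colLen j - (i + 1) : ℕ) + 1)) /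
          (((μ.rowLen i - 1 - j : ℕ) : ℝ) + θ * ((μ.colLen j - (i + 1) : ℕ) + 1)))) *
      (∏ j ∈ Finset.range (μ.rowLen i),
          hookFactor θ ((μ.rowLen i : ℝ) - j) ((μ.colLen j : ℝ) - i - 1) /
            hookFactor θ ((μ.rowLen i : ℝ) - j - 1) ((μ.colLen j : ℝ) - i - 1)) =
      (∏ j ∈ Finset.range (μ.rowLen i),
        (((μ.rowLen i - 1 - j : ℕ) : ℝ) + 2 + θ * (μ.colLen j - (i + 1) : ℕ)) /
          (((μ.rowLen i - 1 - j : ℕ) : ℝ) + 1 + θ * (μ.colLen j - (i + 1) : ℕ))) ^ 2 := by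
    rw [← Finset.prod_mul_distrib, ← Finset.prod_pow]
    refine Finset.prod_congr rfl fun j hj => ?_
    have hj' := Finset.mem_range.1 hj
    have hcol := succ_le_colLen hj'
    have e1 : (μ.rowLen i : ℝ) - j - 1 = ((μ.rowLen i - 1 - j : ℕ) : ℝ) := by
      rw [Nat.sub_sub, Nat.cast_sub (by omega)]; push_cast; ring
    have e2 : (μ.colLen j : ℝ) - i - 1 = ((μ.colLen j - (i + 1) : ℕ) : ℝ) := by
      rw [Nat.cast_sub hcol]; push_cast; ring
    rw [e1, e2, show (μ.rowLen i : ℝ) - j = ((μ.rowLen i - 1 - j : ℕ) : ℝ) + 1 by rw [← e1]; ring]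
    have ha0 : (0 : ℝ) ≤ ((μ.rowLen i - 1 - j : ℕ) : ℝ) := Nat.cast_nonneg _
    have hl0 : (0 : ℝ) ≤ ((μ.colLen j - (i + 1) : ℕ) : ℝ) := Nat.cast_nonneg _
    generalize ((μ.rowLen i - 1 - j : ℕ) : ℝ) = a at ha0 ⊢
    generalize ((μ.colLen j - (i + 1) : ℕ) : ℝ) = l at hl0 ⊢
    rw [hookFactor, hookFactor]
    have n1 : a + θ * (l + 1) ≠ 0 := by positivity
    have n2 : a + 1 + θ * (l + 1) ≠ 0 := by positivity
    have n3 : a + 1 + θ * l ≠ 0 := by positivity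
    rw [show a + 1 + θ * l + 1 = a + 2 + θ * l by ring,
      show a + 1 + θ * l + θ = a + 1 + θ * (l + 1) by ring,
      show a + θ * l + 1 = a + 1 + θ * l by ring, show a + θ * l + θ = a + θ * (l + 1) by ring]
    field_simp
  rw [mul_pow, ← hA, ← hB]
  have := hθ.ne'
  field_simp

end EdgeAt

theorem removalWeight_eq_zero_of_not_removable (θ : ℝ) {lam : YoungDiagram} {i M : ℕ} (hi : i < M)
    (hM : lam.rowLen M = 0) (h : ¬ Removable lam i) :
    removalWeight θ (rowContent θ lam) M i = 0 := by
  simp only [Removable, not_forall, not_lt] at h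
  obtain ⟨k, hk, hle⟩ := h
  have h1 : lam.rowLen (i + 1) = lam.rowLen i := by
    have := lam.rowLen_anti i (i + 1) (by omega)
    have := lam.rowLen_anti (i + 1) k (by omega)
    omega
  rcases eq_or_lt_of_le (Nat.succ_le_of_lt hi) with rfl | hi'
  · have h2 : rowContent θ lam i = - (θ * i) := by
      rw [rowContent, ← h1, hM]; simp
    rw [removalWeight, h2, show -(θ * i) + θ * ((i.succ : ℕ) - 1) = 0 by push_cast; ring, zero_mul]
  · have hmem : i + 1 ∈ (Finset.range M).erase i :=
      Finset.mem_erase.2 ⟨by omega, Finset.mem_range.2 hi'⟩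
    have h2 : rowContent θ lam i - rowContent θ lam (i + 1) - θ = 0 := by
      rw [rowContent, rowContent, h1]; push_cast; ring
    rw [removalWeight, Finset.prod_eq_zero hmem (by rw [h2, zero_div]), mul_zero]

theorem rowContent_injective {θ : ℝ} (hθ : 0 < θ) (lam : YoungDiagram) :
    Function.Injective (rowContent θ lam) := by
  have : StrictAnti (rowContent θ lam) := by
    intro i j hij
    have h1 : (lam.rowLen j : ℝ) ≤ lam.rowLen i := by exact_mod_cast lam.rowLen_anti i j hij.le
    have h2 : θ * i < θ * j := mul_lt_mul_of_pos_left (by exact_mod_cast hij) hθ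
    simp only [rowContent]; linarith
  exact this.injective

theorem sum_removalWeight {θ : ℝ} (hθ : 0 < θ) {lam : YoungDiagram} {M : ℕ}
    (hM : lam.rowLen M = 0) :
    ∑ i ∈ Finset.range M, removalWeight θ (rowContent θ lam) M i = lam.card := by
  have h1 := sum_mul_prod_sub_div θ hθ.ne' (rowContent θ lam) M (θ * (M - 1))
    (rowContent_injective hθ lam).injOn
  have h2 := sum_rowContent θ hM
  have h3 : ∑ i ∈ Finset.range M, (rowContent θ lam i - θ * i) =
      2 * ∑ i ∈ Finset.range M, rowContent θ lam i - ∑ i ∈ Finset.range M, (lam.rowLen i : ℝ) := by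
    rw [Finset.mul_sum, ← Finset.sum_sub_distrib]
    exact Finset.sum_congr rfl fun i _ => by rw [rowContent]; ring
  have h4 : ∑ i ∈ Finset.range M, (lam.rowLen i : ℝ) = lam.card := by
    rw [← sum_rowLen hM]; push_cast; rfl
  simp only [removalWeight]
  rw [h1, h3, h2, h4]
  ring

/-- The recursion along the Young graph satisfied by `n! / √(hookProduct)`. -/
theorem sum_sqrt_edgeWeight_div {θ : ℝ} (hθ : 0 < θ) (lam : YoungDiagram) :
    ∑ μ ∈ downNbrs lam, √(edgeWeight θ μ lam) / √(hookProduct θ μ) =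
      lam.card / √(hookProduct θ lam) := by
  classical
  have hM : lam.rowLen (lam.card + 1) = 0 := rowLen_eq_zero_of_le (rowLen_card lam) (by omega)
  rw [sum_downNbrs, ← sum_removalWeight hθ hM, Finset.sum_div]
  refine Finset.sum_congr rfl fun i hi => ?_
  have hi' := Finset.mem_range.1 hi
  split_ifs with h
  · have h1 := h.edgeAt.edgeWeight_mul_hookProduct hθ hi' hM
    have p1 := hookProduct_pos hθ lam
    have p2 := hookProduct_pos hθ (removeBox lam i)
    have p3 := h.edgeAt.removalWeight_pos hθ hi' hM
    rw [← Real.sqrt_div' _ p2.le, div_eq_div_iff p2.ne' p1.ne' |>.2 h1, Real.sqrt_div' _ p1.le,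
      Real.sqrt_sq p3.le]
  · rw [removalWeight_eq_zero_of_not_removable θ hi' hM h, zero_div]

/-! ### Squares in the Young graph -/

/-- Two distinct diagrams with a common upper neighbour `ν` have `ν` as their union, and their
intersection is a common lower neighbour. -/
theorem Edge.eq_sup {lam ρ ν : YoungDiagram} (hne : lam ≠ ρ) (h1 : Edge lam ν) (h2 : Edge ρ ν) :
    ν = lam ⊔ ρ ∧ Edge (lam ⊓ ρ) lam ∧ Edge (lam ⊓ ρ) ρ := by
  have hle : lam ⊔ ρ ≤ ν := sup_le h1.1 h2.1
  have c1 : (lam ⊔ ρ).card ≤ ν.card := Finset.card_le_card (YoungDiagram.cells_subset_iff.2 hle)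
  have c2 : (lam ⊔ ρ).card + (lam ⊓ ρ).card = lam.card + ρ.card := by
    simp only [YoungDiagram.card, YoungDiagram.cells_sup, YoungDiagram.cells_inf]
    exact Finset.card_union_add_card_inter _ _
  have hlt : lam < lam ⊔ ρ := by
    refine lt_of_le_of_ne le_sup_left fun h => hne ?_
    have : ρ ≤ lam := by rw [h]; exact le_sup_right
    refine (YoungDiagram.ext (Finset.eq_of_subset_of_card_le
      (YoungDiagram.cells_subset_iff.2 this) ?_)).symm
    have := h1.2; have := h2.2
    simp only [YoungDiagram.card] at *; omega
  have c3 : lam.card < (lam ⊔ ρ).card :=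
    Finset.card_lt_card (YoungDiagram.cells_ssubset_iff.2 hlt)
  have e1 := h1.2
  have e2 := h2.2
  refine ⟨?_, ⟨inf_le_left, by omega⟩, inf_le_right, by omega⟩
  refine (YoungDiagram.ext (Finset.eq_of_subset_of_card_le
    (YoungDiagram.cells_subset_iff.2 hle) ?_)).symm
  simp only [YoungDiagram.card] at *; omega

/-- Two distinct diagrams with a common lower neighbour `μ` have `μ` as their intersection, and their
union is a common upper neighbour. -/
theorem Edge.eq_inf {lam ρ μ : YoungDiagram} (hne : lam ≠ ρ) (h1 : Edge μ lam) (h2 : Edge μ ρ) :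
    μ = lam ⊓ ρ ∧ Edge lam (lam ⊔ ρ) ∧ Edge ρ (lam ⊔ ρ) := by
  have hle : μ ≤ lam ⊓ ρ := le_inf h1.1 h2.1
  have c1 : μ.card ≤ (lam ⊓ ρ).card := Finset.card_le_card (YoungDiagram.cells_subset_iff.2 hle)
  have c2 : (lam ⊔ ρ).card + (lam ⊓ ρ).card = lam.card + ρ.card := by
    simp only [YoungDiagram.card, YoungDiagram.cells_sup, YoungDiagram.cells_inf]
    exact Finset.card_union_add_card_inter _ _
  have hlt : lam ⊓ ρ < lam := by
    refine lt_of_le_of_ne inf_le_left fun h => hne ?_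
    have : lam ≤ ρ := by rw [← h]; exact inf_le_right
    refine YoungDiagram.ext (Finset.eq_of_subset_of_card_le
      (YoungDiagram.cells_subset_iff.2 this) ?_)
    have := h1.2; have := h2.2
    simp only [YoungDiagram.card] at *; omega
  have c3 : (lam ⊓ ρ).card < lam.card :=
    Finset.card_lt_card (YoungDiagram.cells_ssubset_iff.2 hlt)
  have e1 := h1.2
  have e2 := h2.2
  refine ⟨?_, ⟨le_sup_left, by omega⟩, le_sup_right, by omega⟩
  refine YoungDiagram.ext (Finset.eq_of_subset_of_card_le
    (YoungDiagram.cells_subset_iff.2 hle) ?_)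
  simp only [YoungDiagram.card] at *; omega

theorem EdgeAt.sup {μ lam ρ : YoungDiagram} {i j : ℕ} (hij : i ≠ j) (h1 : EdgeAt μ lam i)
    (h2 : EdgeAt μ ρ j) : EdgeAt lam (lam ⊔ ρ) j := by
  rw [EdgeAt, YoungDiagram.cells_sup, h1.rowLen_of_ne hij.symm]
  ext x
  have e1 : x ∈ lam.cells ↔ x = (i, μ.rowLen i) ∨ x ∈ μ.cells := by rw [h1, Finset.mem_insert]
  have e2 : x ∈ ρ.cells ↔ x = (j, μ.rowLen j) ∨ x ∈ μ.cells := by rw [h2, Finset.mem_insert]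
  rw [Finset.mem_union, Finset.mem_insert, e1, e2]
  tauto

/-- The contributions of the two paths around a square of the Young graph to `D U` and `U D` agree. -/
theorem jackMultSelfDual_square {θ : ℝ} (hθ : 0 < θ) {lam ρ : YoungDiagram} (hne : lam ≠ ρ)
    (h1 : Edge (lam ⊓ ρ) lam) (h2 : Edge (lam ⊓ ρ) ρ) (q : ℕ × ℕ → ℂ) :
    ((jackMultSelfDual θ lam (lam ⊔ ρ) : ℂ) * q (newBox lam (lam ⊔ ρ))) *
        ((jackMultSelfDual θ ρ (lam ⊔ ρ) : ℂ) * q (newBox ρ (lam ⊔ ρ))) =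
      ((jackMultSelfDual θ (lam ⊓ ρ) lam : ℂ) * q (newBox (lam ⊓ ρ) lam)) *
        ((jackMultSelfDual θ (lam ⊓ ρ) ρ : ℂ) * q (newBox (lam ⊓ ρ) ρ)) := by
  obtain ⟨i, hi⟩ := h1.exists_edgeAt
  obtain ⟨j, hj⟩ := h2.exists_edgeAt
  have hij : i ≠ j := by rintro rfl; exact hne (hi.unique_upper hj)
  have k1 : EdgeAt lam (lam ⊔ ρ) j := hi.sup hij hj
  have k2 : EdgeAt ρ (lam ⊔ ρ) i := by rw [sup_comm]; exact hj.sup hij.symm hi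
  have hw := congrArg Real.sqrt (edgeWeight_square hθ hij hi hj k1 k2)
  rw [Real.sqrt_mul (k1.edgeWeight_pos hθ).le, Real.sqrt_mul (hi.edgeWeight_pos hθ).le] at hw
  have hw' : (jackMultSelfDual θ lam (lam ⊔ ρ) : ℂ) * (jackMultSelfDual θ ρ (lam ⊔ ρ) : ℂ) =
      (jackMultSelfDual θ (lam ⊓ ρ) lam : ℂ) * (jackMultSelfDual θ (lam ⊓ ρ) ρ : ℂ) := by
    exact_mod_cast hw
  rw [k1.newBox_eq, k2.newBox_eq, hi.newBox_eq, hj.newBox_eq, hi.rowLen_of_ne hij.symm,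
    hj.rowLen_of_ne hij]
  linear_combination q (j, (lam ⊓ ρ).rowLen j) * q (i, (lam ⊓ ρ).rowLen i) * hw'

theorem jackMultSelfDual_mul_self {θ : ℝ} (hθ : 0 < θ) {μ ν : YoungDiagram} (h : Edge μ ν) :
    (jackMultSelfDual θ μ ν : ℂ) * (jackMultSelfDual θ μ ν : ℂ) = (edgeWeight θ μ ν : ℂ) := by
  obtain ⟨i, hi⟩ := h.exists_edgeAt
  rw [← Complex.ofReal_mul]
  exact congrArg _ (Real.mul_self_sqrt (hi.edgeWeight_pos hθ).le)

/-! ### Kerov operators -/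

theorem basisVec_apply_self (lam : YoungDiagram) : basisVec lam lam = 1 := by
  simp [basisVec]

theorem basisVec_apply_of_ne {lam ρ : YoungDiagram} (h : lam ≠ ρ) : basisVec lam ρ = 0 := by
  classical
  rw [basisVec, Finsupp.single_apply, if_neg h]

theorem end_ext {A B : Module.End ℂ FinFun} (h : ∀ lam, A (basisVec lam) = B (basisVec lam)) :
    A = B :=
  Finsupp.lhom_ext' fun lam => LinearMap.ext_ring (h lam)

theorem sum_smul_basisVec_apply (s : Finset YoungDiagram) (c : YoungDiagram → ℂ)
    (ρ : YoungDiagram) [Decidable (ρ ∈ s)] :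
    (∑ ν ∈ s, c ν • basisVec ν) ρ = if ρ ∈ s then c ρ else 0 := by
  classical
  rw [Finsupp.finsetSum_apply]
  simp only [Finsupp.smul_apply, basisVec, Finsupp.single_apply, smul_eq_mul, mul_ite, mul_one,
    mul_zero, Finset.sum_ite_eq']
  split_ifs <;> rfl

/-- The raising operator with matrix elements `κ λ ν * q (ν / λ)`. -/
noncomputable def upOp (κ : YoungDiagram → YoungDiagram → ℝ) (q : ℕ × ℕ → ℂ) :
    Module.End ℂ FinFun :=
  Finsupp.linearCombination ℂ fun lam =>
    ∑ ν ∈ upNbrs lam, ((κ lam ν : ℂ) * q (newBox lam ν)) • basisVec ν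

/-- The lowering operator with matrix elements `κ μ λ * q (λ / μ)`. -/
noncomputable def downOp (κ : YoungDiagram → YoungDiagram → ℝ) (q : ℕ × ℕ → ℂ) :
    Module.End ℂ FinFun :=
  Finsupp.linearCombination ℂ fun lam =>
    ∑ μ ∈ downNbrs lam, ((κ μ lam : ℂ) * q (newBox μ lam)) • basisVec μ

/-- The diagonal operator with eigenvalue `2 |λ| + t` at `1_λ`. -/
noncomputable def weightOp (t : ℂ) : Module.End ℂ FinFun :=
  Finsupp.linearCombination ℂ fun lam => (2 * (lam.card : ℂ) + t) • basisVec lam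

theorem upOp_basisVec (κ : YoungDiagram → YoungDiagram → ℝ) (q : ℕ × ℕ → ℂ) (lam : YoungDiagram) :
    upOp κ q (basisVec lam) =
      ∑ ν ∈ upNbrs lam, ((κ lam ν : ℂ) * q (newBox lam ν)) • basisVec ν := by
  rw [upOp, basisVec, Finsupp.linearCombination_single, one_smul]

theorem downOp_basisVec (κ : YoungDiagram → YoungDiagram → ℝ) (q : ℕ × ℕ → ℂ)
    (lam : YoungDiagram) :
    downOp κ q (basisVec lam) =
      ∑ μ ∈ downNbrs lam, ((κ μ lam : ℂ) * q (newBox μ lam)) • basisVec μ := by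
  rw [downOp, basisVec, Finsupp.linearCombination_single, one_smul]

theorem weightOp_basisVec (t : ℂ) (lam : YoungDiagram) :
    weightOp t (basisVec lam) = (2 * (lam.card : ℂ) + t) • basisVec lam := by
  rw [weightOp, basisVec, Finsupp.linearCombination_single, one_smul]; rfl

theorem IsKerovTriplet.eq_upOp {κ : YoungDiagram → YoungDiagram → ℝ} {q : ℕ × ℕ → ℂ}
    {U D H : Module.End ℂ FinFun} (h : IsKerovTriplet κ q U D H) : U = upOp κ q := by
  classical
  refine end_ext fun lam => Finsupp.ext fun ν => ?_
  rw [upOp_basisVec, sum_smul_basisVec_apply, h.up]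
  simp only [mem_upNbrs]

theorem IsKerovTriplet.eq_downOp {κ : YoungDiagram → YoungDiagram → ℝ} {q : ℕ × ℕ → ℂ}
    {U D H : Module.End ℂ FinFun} (h : IsKerovTriplet κ q U D H) : D = downOp κ q := by
  classical
  refine end_ext fun lam => Finsupp.ext fun μ => ?_
  rw [downOp_basisVec, sum_smul_basisVec_apply, h.down]
  simp only [mem_downNbrs]

open Classical in
theorem downOp_upOp_apply (κ : YoungDiagram → YoungDiagram → ℝ) (q : ℕ × ℕ → ℂ)
    (lam ρ : YoungDiagram) :
    downOp κ q (upOp κ q (basisVec lam)) ρ = ∑ ν ∈ upNbrs lam,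
      if Edge ρ ν then ((κ lam ν : ℂ) * q (newBox lam ν)) * ((κ ρ ν : ℂ) * q (newBox ρ ν))
      else 0 := by
  rw [upOp_basisVec, map_sum, Finsupp.finsetSum_apply]
  refine Finset.sum_congr rfl fun ν _ => ?_
  rw [map_smul, downOp_basisVec, Finsupp.smul_apply, sum_smul_basisVec_apply, smul_eq_mul]
  simp only [mem_downNbrs, mul_ite, mul_zero]

open Classical in
theorem upOp_downOp_apply (κ : YoungDiagram → YoungDiagram → ℝ) (q : ℕ × ℕ → ℂ)
    (lam ρ : YoungDiagram) :
    upOp κ q (downOp κ q (basisVec lam)) ρ = ∑ μ ∈ downNbrs lam,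
      if Edge μ ρ then ((κ μ lam : ℂ) * q (newBox μ lam)) * ((κ μ ρ : ℂ) * q (newBox μ ρ))
      else 0 := by
  rw [downOp_basisVec, map_sum, Finsupp.finsetSum_apply]
  refine Finset.sum_congr rfl fun ν _ => ?_
  rw [map_smul, upOp_basisVec, Finsupp.smul_apply, sum_smul_basisVec_apply, smul_eq_mul]
  simp only [mem_upNbrs, mul_ite, mul_zero]

/-- The diagonal matrix elements of `D U - U D`. -/
theorem comm_apply_self {θ : ℝ} (hθ : 0 < θ) (q : ℕ × ℕ → ℂ) (lam : YoungDiagram) :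
    downOp (jackMultSelfDual θ) q (upOp (jackMultSelfDual θ) q (basisVec lam)) lam -
      upOp (jackMultSelfDual θ) q (downOp (jackMultSelfDual θ) q (basisVec lam)) lam =
      ∑ ν ∈ upNbrs lam, (edgeWeight θ lam ν : ℂ) * q (newBox lam ν) ^ 2 -
        ∑ μ ∈ downNbrs lam, (edgeWeight θ μ lam : ℂ) * q (newBox μ lam) ^ 2 := by
  classical
  rw [downOp_upOp_apply, upOp_downOp_apply]
  congr 1
  · refine Finset.sum_congr rfl fun ν hν => ?_
    have he := mem_upNbrs.1 hν
    rw [if_pos he, ← jackMultSelfDual_mul_self hθ he]; ring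
  · refine Finset.sum_congr rfl fun μ hμ => ?_
    have he := mem_downNbrs.1 hμ
    rw [if_pos he, ← jackMultSelfDual_mul_self hθ he]; ring

/-- The off-diagonal matrix elements of `D U - U D` vanish, whatever `q` is. -/
theorem comm_apply_of_ne {θ : ℝ} (hθ : 0 < θ) (q : ℕ × ℕ → ℂ) {lam ρ : YoungDiagram}
    (hne : lam ≠ ρ) :
    downOp (jackMultSelfDual θ) q (upOp (jackMultSelfDual θ) q (basisVec lam)) ρ =
      upOp (jackMultSelfDual θ) q (downOp (jackMultSelfDual θ) q (basisVec lam)) ρ := by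
  classical
  rw [downOp_upOp_apply, upOp_downOp_apply]
  by_cases hP : Edge (lam ⊓ ρ) lam ∧ Edge (lam ⊓ ρ) ρ
  · obtain ⟨-, k1, k2⟩ := hP.1.eq_inf hne hP.2
    rw [Finset.sum_eq_single_of_mem (lam ⊔ ρ) (mem_upNbrs.2 k1), if_pos k2,
      Finset.sum_eq_single_of_mem (lam ⊓ ρ) (mem_downNbrs.2 hP.1), if_pos hP.2]
    · exact jackMultSelfDual_square hθ hne hP.1 hP.2 q
    · intro μ hμ hμ'
      exact if_neg fun he => hμ' ((mem_downNbrs.1 hμ).eq_inf hne he).1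
    · intro ν hν hν'
      exact if_neg fun he => hν' ((mem_upNbrs.1 hν).eq_sup hne he).1
  · rw [Finset.sum_eq_zero, Finset.sum_eq_zero]
    · intro μ hμ
      refine if_neg fun he => hP ?_
      rw [← ((mem_downNbrs.1 hμ).eq_inf hne he).1]
      exact ⟨mem_downNbrs.1 hμ, he⟩
    · intro ν hν
      exact if_neg fun he => hP ((mem_upNbrs.1 hν).eq_sup hne he).2

/-- If the diagonal relation holds at every diagram, the operators form a triplet. -/
theorem isKerovTriplet_of_diagonal {θ : ℝ} (hθ : 0 < θ) {q : ℕ × ℕ → ℂ} {t : ℂ}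
    (h : ∀ lam, ∑ ν ∈ upNbrs lam, (edgeWeight θ lam ν : ℂ) * q (newBox lam ν) ^ 2 -
        ∑ μ ∈ downNbrs lam, (edgeWeight θ μ lam : ℂ) * q (newBox μ lam) ^ 2 =
        2 * (lam.card : ℂ) + t) :
    IsKerovTriplet (jackMultSelfDual θ) q (upOp (jackMultSelfDual θ) q)
      (downOp (jackMultSelfDual θ) q) (weightOp t) where
  up lam ν := by
    classical
    rw [upOp_basisVec, sum_smul_basisVec_apply]; simp only [mem_upNbrs]
  down lam μ := by
    classical
    rw [downOp_basisVec, sum_smul_basisVec_apply]; simp only [mem_downNbrs]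
  comm_H_U := by
    refine end_ext fun lam => ?_
    rw [LieRing.of_associative_ring_bracket, LinearMap.sub_apply, Module.End.mul_apply,
      Module.End.mul_apply, LinearMap.smul_apply, weightOp_basisVec, map_smul, upOp_basisVec,
      map_sum, Finset.smul_sum, Finset.smul_sum, ← Finset.sum_sub_distrib]
    refine Finset.sum_congr rfl fun ν hν => ?_
    rw [map_smul, weightOp_basisVec, (mem_upNbrs.1 hν).2, smul_smul, smul_smul, smul_smul,
      ← sub_smul]
    congr 1; push_cast; ring
  comm_H_D := by
    refine end_ext fun lam => ?_
    rw [LieRing.of_associative_ring_bracket, LinearMap.sub_apply, Module.End.mul_apply,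
      Module.End.mul_apply, LinearMap.smul_apply, weightOp_basisVec, map_smul, downOp_basisVec,
      map_sum, Finset.smul_sum, Finset.smul_sum, ← Finset.sum_sub_distrib]
    refine Finset.sum_congr rfl fun μ hμ => ?_
    rw [map_smul, weightOp_basisVec, (mem_downNbrs.1 hμ).2, smul_smul, smul_smul, smul_smul,
      ← sub_smul]
    congr 1; push_cast; ring
  comm_D_U := by
    refine end_ext fun lam => Finsupp.ext fun ρ => ?_
    rw [LieRing.of_associative_ring_bracket, LinearMap.sub_apply, Module.End.mul_apply,
      Module.End.mul_apply, Finsupp.sub_apply, weightOp_basisVec, Finsupp.smul_apply, smul_eq_mul]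
    by_cases hne : lam = ρ
    · subst hne
      rw [comm_apply_self hθ, h, basisVec_apply_self, mul_one]
    · rw [comm_apply_of_ne hθ q hne, sub_self, basisVec_apply_of_ne hne, mul_zero]
  weight := ⟨t, weightOp_basisVec t⟩

/-- The diagonal relation satisfied by every triplet. -/
theorem IsKerovTriplet.diagonal {θ : ℝ} (hθ : 0 < θ) {q : ℕ × ℕ → ℂ}
    {U D H : Module.End ℂ FinFun} (h : IsKerovTriplet (jackMultSelfDual θ) q U D H) {t : ℂ}
    (ht : ∀ lam, H (basisVec lam) = (2 * (lam.card : ℂ) + t) • basisVec lam) (lam : YoungDiagram) :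
    ∑ ν ∈ upNbrs lam, (edgeWeight θ lam ν : ℂ) * q (newBox lam ν) ^ 2 -
        ∑ μ ∈ downNbrs lam, (edgeWeight θ μ lam : ℂ) * q (newBox μ lam) ^ 2 =
        2 * (lam.card : ℂ) + t := by
  have h1 := ht lam
  rw [← h.comm_D_U, LieRing.of_associative_ring_bracket, h.eq_upOp, h.eq_downOp] at h1
  have h2 := DFunLike.congr_fun h1 lam
  rw [LinearMap.sub_apply, Module.End.mul_apply, Module.End.mul_apply, Finsupp.sub_apply,
    comm_apply_self hθ, Finsupp.smul_apply, basisVec_apply_self, smul_eq_mul, mul_one] at h2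
  exact h2

/-- If `q ^ 2` is of Jack type, the diagonal relation holds with `t = z z' / θ`. -/
theorem diagonal_of_sq_eq {θ : ℝ} (hθ : 0 < θ) {q : ℕ × ℕ → ℂ} {z z' : ℂ}
    (hq : ∀ i j : ℕ, q (i, j) ^ 2 =
      (z + (j : ℂ) - (θ : ℂ) * (i : ℂ)) * (z' + (j : ℂ) - (θ : ℂ) * (i : ℂ)))
    (lam : YoungDiagram) :
    ∑ ν ∈ upNbrs lam, (edgeWeight θ lam ν : ℂ) * q (newBox lam ν) ^ 2 -
        ∑ μ ∈ downNbrs lam, (edgeWeight θ μ lam : ℂ) * q (newBox μ lam) ^ 2 =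
        2 * (lam.card : ℂ) + z * z' / θ := by
  have hq' : ∀ x, q x ^ 2 = (z + content θ x) * (z' + content θ x) := by
    rintro ⟨i, j⟩
    rw [hq, content]; ring
  simp only [hq']
  exact sum_edgeWeight_mul_content hθ lam z z'

/-! ### Uniqueness of the solution of the diagonal relations -/

/-- The rectangle with corner `(i, j)`, without its corner. -/
def cornerlessRectangle (i j : ℕ) : YoungDiagram where
  cells := (Finset.range (i + 1) ×ˢ Finset.range (j + 1)).erase (i, j)
  isLowerSet := by
    rintro ⟨a, b⟩ ⟨c, d⟩ hle hmem
    obtain ⟨hc, hd⟩ : c ≤ a ∧ d ≤ b := hle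
    simp only [Finset.coe_erase, Finset.coe_product, Set.mem_sdiff, Set.mem_prod, Finset.mem_coe,
      Finset.mem_range, Set.mem_singleton_iff, Prod.mk.injEq] at hmem ⊢
    omega

theorem rowLen_cornerlessRectangle (i j k : ℕ) : (cornerlessRectangle i j).rowLen k =
    if k < i then j + 1 else if k = i then j else 0 :=
  rowLen_eq_of_forall fun b => by
    change (k, b) ∈ (Finset.range (i + 1) ×ˢ Finset.range (j + 1)).erase (i, j) ↔ _
    simp only [Finset.mem_erase, Finset.mem_product, Finset.mem_range, Ne, Prod.mk.injEq]
    split_ifs <;> omega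

/-- The homogeneous diagonal relation at a rectangle without corner expresses the value at the
corner by the values at the at most four other boxes that can be added or removed. -/
theorem eq_zero_of_relation {θ : ℝ} (hθ : 0 < θ) {R : ℕ × ℕ → ℂ}
    (hR : ∀ lam, ∑ ν ∈ upNbrs lam, (edgeWeight θ lam ν : ℂ) * R (newBox lam ν) -
        ∑ μ ∈ downNbrs lam, (edgeWeight θ μ lam : ℂ) * R (newBox μ lam) = 0) {i j : ℕ}
    (h1 : 0 < i → R (0, j + 1) = 0) (h2 : 0 < j → R (i + 1, 0) = 0)
    (h3 : 0 < i → R (i - 1, j) = 0) (h4 : 0 < j → R (i, j - 1) = 0) : R (i, j) = 0 := by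
  set lam := cornerlessRectangle i j with hlam
  have hrow := rowLen_cornerlessRectangle i j
  rw [← hlam] at hrow
  have hadd : Addable lam i := by
    intro k hk
    rw [hrow, hrow, if_neg (lt_irrefl i), if_pos rfl, if_pos hk]
    omega
  have hdown : ∑ μ ∈ downNbrs lam, (edgeWeight θ μ lam : ℂ) * R (newBox μ lam) = 0 := by
    refine Finset.sum_eq_zero fun μ hμ => ?_
    obtain ⟨k, hk⟩ := (mem_downNbrs.1 hμ).exists_edgeAt
    have hrem := hk.removable (k + 1) (by omega)
    have hself := hk.rowLen_self
    rw [hk.newBox_eq]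
    rw [hrow] at hself
    rw [hrow, hrow] at hrem
    have : R (k, μ.rowLen k) = 0 := by
      rcases lt_trichotomy k i with hki | rfl | hki
      · obtain rfl : i = k + 1 := by
          by_contra hne
          rw [if_pos (by omega), if_pos hki] at hrem
          omega
        rw [if_pos hki] at hself
        obtain rfl : j = μ.rowLen k := by omega
        exact h3 (by omega)
      · rw [if_neg (by omega), if_pos rfl] at hself
        obtain rfl : j = μ.rowLen k + 1 := by omega
        exact h4 (by omega)
      · rw [if_neg (by omega), if_neg (by omega)] at hself
        omega
    rw [this, mul_zero]
  have hup : ∑ ν ∈ upNbrs lam, (edgeWeight θ lam ν : ℂ) * R (newBox lam ν) =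
      (edgeWeight θ lam (addBox lam i) : ℂ) * R (newBox lam (addBox lam i)) := by
    refine Finset.sum_eq_single_of_mem _ (mem_upNbrs.2 hadd.edgeAt.edge) fun ν hν hne => ?_
    obtain ⟨k, hk⟩ := (mem_upNbrs.1 hν).exists_edgeAt
    have hki : k ≠ i := by rintro rfl; exact hne (hk.unique_upper hadd.edgeAt)
    have ha := hk.addable
    rw [hk.newBox_eq]
    have : R (k, lam.rowLen k) = 0 := by
      rcases lt_or_gt_of_ne hki with hki | hki
      · rcases Nat.eq_zero_or_pos k with rfl | hk0
        · rw [hrow, if_pos hki]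
          exact h1 hki
        · have := ha (k - 1) (by omega)
          rw [hrow, hrow, if_pos hki, if_pos (by omega)] at this
          omega
      · have hi := ha i hki
        rw [hrow, hrow, if_neg (by omega), if_neg (by omega), if_neg (by omega), if_pos rfl] at hi
        rcases eq_or_lt_of_le (Nat.succ_le_of_lt hki) with rfl | hki'
        · rw [hrow, if_neg (by omega), if_neg (by omega)]
          exact h2 hi
        · have := ha (i + 1) hki'
          rw [hrow, hrow, if_neg (by omega), if_neg (by omega), if_neg (by omega),
            if_neg (by omega)] at this
          omega
    rw [this, mul_zero]
  have hrel := hR lam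
  rw [hdown, hup, sub_zero, hadd.edgeAt.newBox_eq, hrow, if_neg (lt_irrefl i), if_pos rfl,
    mul_eq_zero] at hrel
  refine hrel.resolve_left ?_
  exact_mod_cast (hadd.edgeAt.edgeWeight_pos hθ).ne'

/-- A solution of the homogeneous diagonal relations that vanishes at the first two boxes of the
first row vanishes. -/
theorem eq_zero_of_relations {θ : ℝ} (hθ : 0 < θ) {R : ℕ × ℕ → ℂ}
    (hR : ∀ lam, ∑ ν ∈ upNbrs lam, (edgeWeight θ lam ν : ℂ) * R (newBox lam ν) -
        ∑ μ ∈ downNbrs lam, (edgeWeight θ μ lam : ℂ) * R (newBox μ lam) = 0)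
    (h00 : R (0, 0) = 0) (h01 : R (0, 1) = 0) (i j : ℕ) : R (i, j) = 0 := by
  have h10 : R (1, 0) = 0 := eq_zero_of_relation hθ hR (fun _ => h01) (fun h => by omega)
    (fun _ => h00) (fun h => by omega)
  have hrow : ∀ j, R (0, j) = 0 := by
    intro j
    induction j with
    | zero => exact h00
    | succ j ih =>
      exact eq_zero_of_relation hθ hR (fun h => by omega) (fun _ => h10)
        (fun h => by omega) (fun _ => ih)
  have hcol : ∀ i, R (i, 0) = 0 := by
    intro i
    induction i with
    | zero => exact h00
    | succ i ih =>
      exact eq_zero_of_relation hθ hR (fun _ => h01) (fun h => by omega)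
        (fun _ => ih) (fun h => by omega)
  induction i generalizing j with
  | zero => exact hrow j
  | succ i ihi =>
    induction j with
    | zero => exact hcol _
    | succ j ihj =>
      exact eq_zero_of_relation hθ hR (fun _ => hrow _) (fun _ => hcol _)
        (fun _ => ihi _) (fun _ => ihj)

/-- The defining function of a triplet has a square of Jack type: `z` and `z'` are chosen so that
the squares agree at the boxes `(0, 0)` and `(0, 1)`. -/
theorem IsKerovTriplet.exists_sq_eq {θ : ℝ} (hθ : 0 < θ) {q : ℕ × ℕ → ℂ}
    {U D H : Module.End ℂ FinFun} (h : IsKerovTriplet (jackMultSelfDual θ) q U D H) :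
    ∃ z z' : ℂ, ∀ i j : ℕ, q (i, j) ^ 2 =
      (z + (j : ℂ) - (θ : ℂ) * (i : ℂ)) * (z' + (j : ℂ) - (θ : ℂ) * (i : ℂ)) := by
  obtain ⟨t, ht⟩ := h.weight
  have hdiag := h.diagonal hθ ht
  set s : ℂ := q (0, 1) ^ 2 - q (0, 0) ^ 2 - 1 with hs
  -- `z` and `z'` are the roots of `X ^ 2 - s X + q (0, 0) ^ 2`
  obtain ⟨d, hd⟩ := IsAlgClosed.exists_pow_nat_eq (s ^ 2 - 4 * q (0, 0) ^ 2) (n := 2) two_pos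
  set z : ℂ := (s + d) / 2 with hz
  set z' : ℂ := (s - d) / 2 with hz'
  have hprod : z * z' = q (0, 0) ^ 2 := by
    rw [hz, hz']; linear_combination (-1 / 4 : ℂ) * hd
  have hsum : z + z' = s := by rw [hz, hz']; ring
  set R : ℕ × ℕ → ℂ := fun x => q x ^ 2 - (z + content θ x) * (z' + content θ x) with hRdef
  have h00 : R (0, 0) = 0 := by
    simp only [hRdef, content]; push_cast; linear_combination - hprod
  have h01 : R (0, 1) = 0 := by
    simp only [hRdef, content]; push_cast; linear_combination - hprod - hsum + hs
  have hdiff : ∀ lam, ∑ ν ∈ upNbrs lam, (edgeWeight θ lam ν : ℂ) * R (newBox lam ν) -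
        ∑ μ ∈ downNbrs lam, (edgeWeight θ μ lam : ℂ) * R (newBox μ lam) = t - z * z' / θ := by
    intro lam
    have h1 := hdiag lam
    have h2 := sum_edgeWeight_mul_content hθ lam z z'
    simp only [hRdef, mul_sub, Finset.sum_sub_distrib]
    linear_combination h1 - h2
  -- the relation at the empty diagram, where only the box `(0, 0)` can be added
  have ht0 : t - z * z' / θ = 0 := by
    rw [← hdiff ⊥, Finset.sum_eq_zero, Finset.sum_eq_zero, sub_self]
    · intro μ hμ
      have := (mem_downNbrs.1 hμ).2
      simp [YoungDiagram.card] at this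
    · intro ν hν
      obtain ⟨i, hi⟩ := (mem_upNbrs.1 hν).exists_edgeAt
      have hr : ∀ k, (⊥ : YoungDiagram).rowLen k = 0 := fun k =>
        rowLen_eq_of_forall fun j => by simp
      have hi0 : i = 0 := by
        by_contra hne
        have := hi.addable 0 (by omega)
        rw [hr, hr] at this
        omega
      rw [hi.newBox_eq, hr, hi0, h00, mul_zero]
  refine ⟨z, z', fun i j => ?_⟩
  have := eq_zero_of_relations hθ (fun lam => (hdiff lam).trans ht0) h00 h01 i j
  simp only [hRdef, content] at this
  linear_combination this

/-! ### Powers of the raising and lowering operators -/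

theorem upOp_apply (κ : YoungDiagram → YoungDiagram → ℝ) (q : ℕ × ℕ → ℂ) (v : FinFun)
    (lam : YoungDiagram) :
    upOp κ q v lam = ∑ μ ∈ downNbrs lam, ((κ μ lam : ℂ) * q (newBox μ lam)) * v μ := by
  classical
  induction v using Finsupp.induction_linear with
  | zero => simp
  | add f g hf hg =>
    simp only [map_add, Finsupp.add_apply, hf, hg, mul_add, Finset.sum_add_distrib]
  | single ρ c =>
    have : (Finsupp.single ρ c : FinFun) = c • basisVec ρ := by simp [basisVec]
    rw [this, map_smul, upOp_basisVec, Finsupp.smul_apply, sum_smul_basisVec_apply]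
    simp only [Finsupp.smul_apply, basisVec, Finsupp.single_apply, smul_eq_mul, mul_ite, mul_one,
      mul_zero, Finset.sum_ite_eq, mem_upNbrs, mem_downNbrs]
    split_ifs <;> ring

theorem upOp_pow_apply_of_card_ne (κ : YoungDiagram → YoungDiagram → ℝ) (q : ℕ × ℕ → ℂ) (n : ℕ)
    {lam : YoungDiagram} (h : lam.card ≠ n) : (upOp κ q ^ n) (basisVec ⊥) lam = 0 := by
  induction n generalizing lam with
  | zero =>
    rw [pow_zero, Module.End.one_apply]
    refine basisVec_apply_of_ne fun h0 => h ?_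
    rw [← h0]; simp [YoungDiagram.card]
  | succ n ih =>
    rw [pow_succ', Module.End.mul_apply, upOp_apply]
    refine Finset.sum_eq_zero fun μ hμ => ?_
    have := (mem_downNbrs.1 hμ).2
    rw [ih (by omega), mul_zero]

theorem eq_bot_of_card {lam : YoungDiagram} (h : lam.card = 0) : lam = ⊥ :=
  YoungDiagram.ext (Finset.card_eq_zero.1 h)

/-- The weighted sum over the paths from `∅` to `λ`, characterized by its recursion, is
`n! / √(H H') ∏ q`. -/
theorem path_recursion {θ : ℝ} (hθ : 0 < θ) (q : ℕ × ℕ → ℂ) (P : ℕ → YoungDiagram → ℂ)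
    (h0 : P 0 ⊥ = 1) (hs : ∀ n lam, P (n + 1) lam = ∑ μ ∈ downNbrs lam,
      ((jackMultSelfDual θ μ lam : ℂ) * q (newBox μ lam)) * P n μ)
    (n : ℕ) {lam : YoungDiagram} (hn : lam.card = n) :
    P n lam = (n.factorial : ℂ) / (√(hookProduct θ lam) : ℝ) * ∏ x ∈ lam.cells, q x := by
  induction n generalizing lam with
  | zero =>
    rw [eq_bot_of_card hn, h0]
    simp [hookProduct]
  | succ n ih =>
    have key := congrArg Complex.ofReal (sum_sqrt_edgeWeight_div hθ lam)
    rw [hs]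
    have e : ∀ μ ∈ downNbrs lam, ((jackMultSelfDual θ μ lam : ℂ) * q (newBox μ lam)) * P n μ =
        ((n.factorial : ℂ) * ∏ x ∈ lam.cells, q x) *
          ((√(edgeWeight θ μ lam) / √(hookProduct θ μ) : ℝ) : ℂ) := by
      intro μ hμ
      have hE := mem_downNbrs.1 hμ
      obtain ⟨i, hi⟩ := hE.exists_edgeAt
      have hc := hE.2
      have hj : jackMultSelfDual θ μ lam = √(edgeWeight θ μ lam) := rfl
      rw [ih (by omega), hi.newBox_eq, hi, Finset.prod_insert (notMem_rowEnd μ i), hj]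
      push_cast
      ring
    rw [Finset.sum_congr rfl e, ← Finset.mul_sum, ← Complex.ofReal_sum, key, hn,
      Nat.factorial_succ]
    push_cast
    ring

/-- The weight of a diagram is `n!² ∏ q² / (H H')`. -/
theorem IsKerovTriplet.unnormalizedWeight_eq {θ : ℝ} (hθ : 0 < θ) {q : ℕ × ℕ → ℂ}
    {U D H : Module.End ℂ FinFun} (h : IsKerovTriplet (jackMultSelfDual θ) q U D H) {n : ℕ}
    {lam : YoungDiagram} (hn : lam.card = n) :
    unnormalizedWeight U D n lam =
      (n.factorial : ℂ) ^ 2 / (hookProduct θ lam : ℂ) * ∏ x ∈ lam.cells, q x ^ 2 := by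
  have h1 := path_recursion hθ q (fun n lam => (U ^ n) (basisVec ⊥) lam)
    (by simp [basisVec]) (fun n lam => by
      rw [pow_succ', Module.End.mul_apply, h.eq_upOp, upOp_apply]) n hn
  have h2 := path_recursion hθ q (fun n lam => (D ^ n) (basisVec lam) ⊥)
    (by simp [basisVec]) (fun n lam => by
      rw [pow_succ, Module.End.mul_apply, h.eq_downOp, downOp_basisVec, map_sum,
        Finsupp.finsetSum_apply]
      exact Finset.sum_congr rfl fun μ _ => by rw [map_smul, Finsupp.smul_apply, smul_eq_mul]) n hn
  have h3 : ((√(hookProduct θ lam) : ℝ) : ℂ) ^ 2 = (hookProduct θ lam : ℂ) := by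
    exact_mod_cast Real.sq_sqrt (hookProduct_pos hθ lam).le
  beta_reduce at h1 h2
  rw [unnormalizedWeight, h1, h2, Finset.prod_pow, ← h3]
  ring

/-- The `sl(2)` computation of `D U^{n+1}` at the vacuum vector. -/
theorem IsKerovTriplet.down_up_pow {κ : YoungDiagram → YoungDiagram → ℝ} {q : ℕ × ℕ → ℂ}
    {U D H : Module.End ℂ FinFun} (h : IsKerovTriplet κ q U D H) {t : ℂ}
    (ht : ∀ lam, H (basisVec lam) = (2 * (lam.card : ℂ) + t) • basisVec lam) (n : ℕ) :
    D ((U ^ (n + 1)) (basisVec ⊥)) = (((n : ℂ) + 1) * (n + t)) • (U ^ n) (basisVec ⊥) := by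
  have hDU : ∀ v, D (U v) = U (D v) + H v := by
    intro v
    have := DFunLike.congr_fun h.comm_D_U v
    rw [LieRing.of_associative_ring_bracket, LinearMap.sub_apply, Module.End.mul_apply,
      Module.End.mul_apply] at this
    rw [← this]; abel
  have hHU : ∀ v, H (U v) = U (H v) + (2 : ℂ) • U v := by
    intro v
    have := DFunLike.congr_fun h.comm_H_U v
    rw [LieRing.of_associative_ring_bracket, LinearMap.sub_apply, Module.End.mul_apply,
      Module.End.mul_apply, LinearMap.smul_apply] at this
    rw [← this]; abel
  have hH : ∀ n : ℕ, H ((U ^ n) (basisVec ⊥)) = (2 * (n : ℂ) + t) • (U ^ n) (basisVec ⊥) := by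
    intro n
    induction n with
    | zero => simpa [YoungDiagram.card] using ht ⊥
    | succ n ih =>
      rw [pow_succ', Module.End.mul_apply, hHU, ih, map_smul, ← add_smul]
      congr 1; push_cast; ring
  have hD : D (basisVec ⊥) = 0 := by
    rw [h.eq_downOp, downOp_basisVec]
    refine Finset.sum_eq_zero fun μ hμ => ?_
    have := (mem_downNbrs.1 hμ).2
    simp [YoungDiagram.card] at this
  induction n with
  | zero =>
    have := hH 0
    rw [pow_zero, Module.End.one_apply] at this
    rw [zero_add, pow_one, pow_zero, Module.End.one_apply, hDU, hD, map_zero, zero_add, this]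
    congr 1; push_cast; ring
  | succ n ih =>
    rw [pow_succ' U (n + 1), Module.End.mul_apply, hDU, ih, map_smul, hH, ← Module.End.mul_apply,
      ← pow_succ', ← add_smul]
    congr 1; push_cast; ring

theorem IsKerovTriplet.down_pow_up_pow {κ : YoungDiagram → YoungDiagram → ℝ} {q : ℕ × ℕ → ℂ}
    {U D H : Module.End ℂ FinFun} (h : IsKerovTriplet κ q U D H) {t : ℂ}
    (ht : ∀ lam, H (basisVec lam) = (2 * (lam.card : ℂ) + t) • basisVec lam) (n : ℕ) :
    (D ^ n) ((U ^ n) (basisVec ⊥)) =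
      ((n.factorial : ℂ) * (ascPochhammer ℂ n).eval t) • basisVec ⊥ := by
  induction n with
  | zero => simp
  | succ n ih =>
    rw [pow_succ D, Module.End.mul_apply, h.down_up_pow ht, map_smul, ih, smul_smul,
      ascPochhammer_succ_eval, Nat.factorial_succ]
    congr 1; push_cast; ring

theorem IsKerovTriplet.normalization_eq {κ : YoungDiagram → YoungDiagram → ℝ} {q : ℕ × ℕ → ℂ}
    {U D H : Module.End ℂ FinFun} (h : IsKerovTriplet κ q U D H) {t : ℂ}
    (ht : ∀ lam, H (basisVec lam) = (2 * (lam.card : ℂ) + t) • basisVec lam) (n : ℕ) :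
    normalization U D n = (n.factorial : ℂ) * (ascPochhammer ℂ n).eval t := by
  classical
  have hzero : ∀ lam : YoungDiagram, lam.card ≠ n → (U ^ n) (basisVec ⊥) lam = 0 := fun lam hn => by
    rw [h.eq_upOp]; exact upOp_pow_apply_of_card_ne κ q n hn
  have h1 : normalization U D n = ∑ᶠ lam, unnormalizedWeight U D n lam := by
    refine finsum_congr fun lam => ?_
    rw [finsum_eq_if]
    split_ifs with hn
    · rfl
    · rw [unnormalizedWeight, hzero lam hn, zero_mul]
  rw [h1, finsum_eq_sum_of_support_subset (s := ((U ^ n) (basisVec ⊥)).support)]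
  · -- both sides are `(D ^ n U ^ n 1_∅, 1_∅)`, with `U ^ n 1_∅` expanded in the basis
    have h2 := DFunLike.congr_fun (h.down_pow_up_pow ht n) ⊥
    rw [Finsupp.smul_apply, basisVec_apply_self, smul_eq_mul, mul_one] at h2
    rw [← h2]
    set v := (U ^ n) (basisVec ⊥) with hv
    have h3 : v = ∑ lam ∈ v.support, v lam • basisVec lam := by
      conv_lhs => rw [← Finsupp.sum_single v]
      refine Finset.sum_congr rfl fun lam _ => ?_
      rw [basisVec, Finsupp.smul_single, smul_eq_mul, mul_one]
    conv_rhs => rw [h3]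
    rw [map_sum, Finsupp.finsetSum_apply]
    refine Finset.sum_congr rfl fun lam _ => ?_
    rw [map_smul, Finsupp.smul_apply, smul_eq_mul]
    rfl
  · intro lam hlam
    rw [Function.mem_support] at hlam
    rw [Finset.mem_coe, Finsupp.mem_support_iff]
    exact fun h0 => hlam (by rw [unnormalizedWeight, h0, zero_mul])

end KerovJack

theorem mainTheorem8 (θ : ℝ) (hθ : 0 < θ) :
    -- a function on boxes defines a triplet of Kerov's operators iff its square is of Jack type
    (∀ q : ℕ × ℕ → ℂ,
      (∃ U D H : Module.End ℂ KerovJack.FinFun,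
        KerovJack.IsKerovTriplet (KerovJack.jackMultSelfDual θ) q U D H) ↔
      ∃ z z' : ℂ, ∀ i j : ℕ,
        q (i, j) ^ 2 = (z + (j : ℂ) - (θ : ℂ) * (i : ℂ)) * (z' + (j : ℂ) - (θ : ℂ) * (i : ℂ))) ∧
    -- the parameters are determined up to their order
    (∀ z z' w w' : ℂ,
      (∀ i j : ℕ,
        (z + (j : ℂ) - (θ : ℂ) * (i : ℂ)) * (z' + (j : ℂ) - (θ : ℂ) * (i : ℂ)) =
          (w + (j : ℂ) - (θ : ℂ) * (i : ℂ)) * (w' + (j : ℂ) - (θ : ℂ) * (i : ℂ))) →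
      (w = z ∧ w' = z') ∨ (w = z' ∧ w' = z)) ∧
    -- the parameter `t` and the measures arising from the triplet
    (∀ (q : ℕ × ℕ → ℂ) (U D H : Module.End ℂ KerovJack.FinFun) (z z' : ℂ),
      KerovJack.IsKerovTriplet (KerovJack.jackMultSelfDual θ) q U D H →
      (∀ i j : ℕ,
        q (i, j) ^ 2 =
          (z + (j : ℂ) - (θ : ℂ) * (i : ℂ)) * (z' + (j : ℂ) - (θ : ℂ) * (i : ℂ))) →
      KerovJack.vacuumWeight H = z * z' / (θ : ℂ) ∧
      ∀ n : ℕ,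
        KerovJack.normalization U D n =
          (n.factorial : ℂ) * (ascPochhammer ℂ n).eval (z * z' / (θ : ℂ)) ∧
        (KerovJack.normalization U D n ≠ 0 →
          ∀ lam : YoungDiagram, lam.card = n →
            KerovJack.kerovMeasure U D n lam = KerovJack.jackZMeasure θ z z' n lam)) := by
  refine ⟨fun q => ⟨?_, ?_⟩, ?_, ?_⟩
  · rintro ⟨U, D, H, h⟩
    exact h.exists_sq_eq hθ
  · rintro ⟨z, z', hq⟩
    exact ⟨_, _, _, KerovJack.isKerovTriplet_of_diagonal hθ (KerovJack.diagonal_of_sq_eq hθ hq)⟩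
  · intro z z' w w' h
    have h0 : z * z' = w * w' := by simpa using h 0 0
    have h1 : (z + 1) * (z' + 1) = (w + 1) * (w' + 1) := by simpa using h 0 1
    have h2 : z + z' = w + w' := by linear_combination h1 - h0
    have h3 : (w - z) * (w - z') = 0 := by linear_combination h0 - w * h2
    rcases mul_eq_zero.1 h3 with h4 | h4
    · exact Or.inl ⟨sub_eq_zero.1 h4, by linear_combination -h2 - h4⟩
    · exact Or.inr ⟨sub_eq_zero.1 h4, by linear_combination -h2 - h4⟩
  · intro q U D H z z' h hq
    obtain ⟨t, ht⟩ := h.weight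
    obtain rfl : t = z * z' / θ := by
      have h1 := h.diagonal hθ ht ⊥
      rw [KerovJack.diagonal_of_sq_eq hθ hq] at h1
      linear_combination -h1
    refine ⟨?_, fun n => ⟨h.normalization_eq ht n, fun _ lam hn => ?_⟩⟩
    · rw [KerovJack.vacuumWeight, ht, Finsupp.smul_apply, KerovJack.basisVec_apply_self]
      simp [YoungDiagram.card]
    · rw [KerovJack.kerovMeasure, h.normalization_eq ht n, h.unnormalizedWeight_eq hθ hn,
        KerovJack.jackZMeasure]
      have hq' : ∏ x ∈ lam.cells, q x ^ 2 =
          ∏ x ∈ lam.cells, ((z + KerovJack.content θ x) * (z' + KerovJack.content θ x)) := by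
        refine Finset.prod_congr rfl fun x _ => ?_
        obtain ⟨i, j⟩ := x
        rw [hq, KerovJack.content]; ring
      rw [hq']
      have hf : (n.factorial : ℂ) ≠ 0 := by exact_mod_cast n.factorial_ne_zero
      generalize (∏ x ∈ lam.cells, ((z + KerovJack.content θ x) * (z' + KerovJack.content θ x))) = P
      generalize (n.factorial : ℂ) = f at hf ⊢
      simp only [div_eq_mul_inv, mul_inv]
      linear_combination (f * (KerovJack.hookProduct θ lam : ℂ)⁻¹ * P *
        ((ascPochhammer ℂ n).eval (z * z' * (θ : ℂ)⁻¹))⁻¹) * mul_inv_cancel₀ hf
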